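/- For a topological space $X$, let $\operatorname{cat}_g X\in\{0,1,2,\dots\}\cup\{\infty\}$ be the smallest integer $n\ge 0$ such that $X=\bigcup_{i=0}^{n}A_i$ for some arbitrary subsets $A_i\subseteq X$, each contractible in $X$, i.e. such that the inclusion $A_i\hookrightarrow X$ is homotopic to a constant map ($\operatorname{cat}_g X=\infty$ if there is no such $n$). Let $\dim X$ be the covering dimension of $X$ (possibly $\infty$). A space $X$ is $k$-connected ($C^k$) if it is nonempty and $\pi_r(X,x)$ is trivial for all $0\le r\le k$ and all $x\in X$. It is locally $k$-connected ($LC^k$) if for every $x\in X$ and every neighborhood $U$ of $x$ there is a neighborhood $V$ of $x$ with $V\subseteq U$ such that, for every $0\le r\le k$, every continuous map $S^r\to V$ is nullhomotopic in $U$. **Theorem.** Let $k\ge 0$ be an integer and let $X$ be a compact metrizable space that is $LC^k$ and $C^k$. Then $$\operatorname{cat}_g X\le \frac{\dim X}{k+1}.$$ In particular, if $X$ is a Peano continuum (a nonempty, path connected, locally path connected, compact metrizable space), then $\operatorname{cat}_g X\le\dim X$. -/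

import Mathlib

open Set Topology TopologicalSpace
open scoped ENNReal Topology.Homotopy

/-- A subset `A` of `X` is contractible in `X` if the inclusion map `A → X` is homotopic to a
constant map. -/
def ContractibleIn {X : Type*} [TopologicalSpace X] (A : Set X) : Prop :=
  (ContinuousMap.mk (Subtype.val : A → X) continuous_subtype_val).Nullhomotopic

/-- The general Lusternik-Schnirelmann category `cat_g X`: the smallest `n` such that `X` is the
union of `n + 1` arbitrary subsets `A 0, …, A n`, each contractible in `X`
(`⊤` if there is no such `n`). -/
noncomputable def generalLSCat (X : Type*) [TopologicalSpace X] : ℕ∞ :=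
  ⨅ (n : ℕ) (_ : ∃ A : Fin (n + 1) → Set X, (⋃ i, A i) = univ ∧ ∀ i, ContractibleIn (A i)),
    (n : ℕ∞)

/-- `dim X ≤ n` for the (Lebesgue) covering dimension: every finite open cover of `X` has a finite
open refinement such that every point lies in at most `n + 1` of its members. -/
def CoveringDimLE (X : Type*) [TopologicalSpace X] (n : ℕ) : Prop :=
  ∀ 𝒰 : Set (Set X), 𝒰.Finite → (∀ U ∈ 𝒰, IsOpen U) → ⋃₀ 𝒰 = univ →
    ∃ 𝒱 : Set (Set X), 𝒱.Finite ∧ (∀ V ∈ 𝒱, IsOpen V) ∧ ⋃₀ 𝒱 = univ ∧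
      (∀ V ∈ 𝒱, ∃ U ∈ 𝒰, V ⊆ U) ∧ ∀ x : X, {V ∈ 𝒱 | x ∈ V}.encard ≤ n + 1

/-- The covering dimension `dim X` of a nonempty space `X` (`⊤` if `X` is infinite-dimensional). -/
noncomputable def coveringDim (X : Type*) [TopologicalSpace X] : ℕ∞ :=
  ⨅ (n : ℕ) (_ : CoveringDimLE X n), (n : ℕ∞)

/-- `X` is `k`-connected (`C^k`): it is nonempty and `π_0, …, π_k` are trivial at every
base point. -/
structure IsKConnected (k : ℕ) (X : Type*) [TopologicalSpace X] : Prop where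
  nonempty : Nonempty X
  subsingleton_pi : ∀ r ≤ k, ∀ x : X, Subsingleton (π_ r X x)

/-- `X` is locally `k`-connected (`LC^k`): every neighborhood `U` of a point `x` contains a
neighborhood `V` of `x` such that, for `r ≤ k`, every map `S^r → V` is nullhomotopic in `U`. -/
def IsLocallyKConnected (k : ℕ) (X : Type*) [TopologicalSpace X] : Prop :=
  ∀ x : X, ∀ U ∈ 𝓝 x, ∃ V ∈ 𝓝 x, ∃ hVU : V ⊆ U, ∀ r ≤ k,
    ∀ f : C(Metric.sphere (0 : EuclideanSpace ℝ (Fin (r + 1))) 1, V),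
      ((ContinuousMap.mk (Set.inclusion hVU) (continuous_inclusion hVU)).comp f).Nullhomotopic

/-!
Let `n = dim X`.  The space is cut into `n + 1` zero-dimensional sets, these are grouped into blocks
of `k + 1`, and each block, a set of dimension at most `k`, is contracted in `X`.

*The decomposition.*  A map from `X` to `ℝⁿ⁺¹` can be moved off the origin by a small change
(`CoveringDimLE.exists_ne_zero_near`), so by the Baire category theorem there is a sequence of
functions `f i` on `X`, rich enough that the sets `{f i > 0}` form a base, of which at most `n`
vanish at any point (`CoveringDimLE.exists_generic_functions`).  The set of points where exactly `c`
of them vanish is zero-dimensional: it is the countable union, over all sets `S` of `c` indices, of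
the closed pieces where precisely the `f i` with `i ∈ S` vanish, and on such a piece the remaining
functions have constant sign on clopen sets.  The countable sum theorem
(`exists_isClopen_of_iUnion_closed`) puts the pieces together.

*The contraction.*  Triviality of the homotopy groups, in the global and in the uniform local form,
allows boundaries of simplices of dimension at most `k + 1` to be filled, small ones by small
fillings (`exists_controlled_filling`).  Skeleton by skeleton, this maps all simplices with at
most `k + 2` vertices in `X` to `X` (`exists_simplexwise_map`).  If `A` is a union of `k + 1`
zero-dimensional sets, take a sequence of finite disjoint families of open sets, finer and finer, in
which the zero-dimensional sets are covered in cyclic order.  Any `k + 1` consecutive families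
cover `A`, and letting them fade in and out one at a time gives, at each time, weights on at most
`k + 2` points of `X` that converge to the given point of `A`.  The image of these weights under the
simplexwise map is a homotopy from the inclusion of `A` to a constant map
(`contractibleIn_of_zeroDim_union`).
-/

/-! ### Functions in general position on a space of covering dimension at most `n` -/

/-- In a finite-dimensional space, finitely many points can be moved by arbitrarily little so that
any `finrank` of them become linearly independent. -/
theorem exists_linearIndepOn_near {E : Type*} [NormedAddCommGroup E] [NormedSpace ℝ E]
    [FiniteDimensional ℝ E] {ι : Type*} (c : ι → E) {ε : ℝ} (hε : 0 < ε) (s : Finset ι) :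
    ∃ p : ι → E, (∀ i, ‖p i - c i‖ < ε) ∧
      ∀ T ⊆ s, T.card ≤ Module.finrank ℝ E → LinearIndepOn ℝ p (T : Set ι) := by
  classical
  induction s using Finset.induction_on with
  | empty =>
    refine ⟨c, fun i => by simpa using hε, fun T hT _ => ?_⟩
    rw [Finset.subset_empty.1 hT]
    simp
  | insert a s ha ih =>
    obtain ⟨p, hp, hT⟩ := ih
    let 𝒯 : Set (Finset ι) := {T | T ⊆ s ∧ T.card < Module.finrank ℝ E}
    have hfin : 𝒯.Finite := s.powerset.finite_toSet.subset fun T hT => by simpa using hT.1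
    have hdense : Dense (⋂ T ∈ 𝒯, ((Submodule.span ℝ (p '' (T : Set ι)) : Set E))ᶜ) := by
      refine dense_biInter_of_isOpen (fun T _ => ?_) hfin.countable (fun T hTc => ?_)
      · exact (Submodule.closed_of_finiteDimensional _).isOpen_compl
      · rw [← interior_eq_empty_iff_dense_compl, ← not_nonempty_iff_eq_empty]
        intro hne
        have htop := Submodule.eq_top_of_nonempty_interior' _ hne
        have h1 : Module.finrank ℝ (Submodule.span ℝ (p '' (T : Set ι))) ≤ T.card := by
          have := finrank_span_finset_le_card (R := ℝ) (T.image p)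
          rw [Finset.coe_image] at this
          exact this.trans Finset.card_image_le
        rw [htop, finrank_top] at h1
        exact absurd hTc.2 (not_lt.2 h1)
    obtain ⟨q, hq, hqc⟩ := hdense.exists_dist_lt (c a) hε
    refine ⟨Function.update p a q, fun i => ?_, fun T hTs hTc => ?_⟩
    · by_cases h : i = a
      · subst h
        rw [Function.update_self, ← dist_eq_norm, dist_comm]
        exact hqc
      · rw [Function.update_of_ne h]
        exact hp i
    · have hcongr : ∀ T : Finset ι, a ∉ T → EqOn (Function.update p a q) p (T : Set ι) := by
        intro T haT i hi
        exact Function.update_of_ne (by rintro rfl; exact haT hi) _ _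
      by_cases haT : a ∈ T
      · have hsub : T.erase a ⊆ s := fun i hi => by
          have := hTs (Finset.mem_of_mem_erase hi)
          exact (Finset.mem_insert.1 this).resolve_left (Finset.ne_of_mem_erase hi)
        have hlt : (T.erase a).card < Module.finrank ℝ E :=
          (Finset.card_erase_lt_of_mem haT).trans_le hTc
        have hTe : (T : Set ι) = insert a ((T.erase a : Finset ι) : Set ι) := by
          rw [← Finset.coe_insert, Finset.insert_erase haT]
        rw [hTe, linearIndepOn_insert (by simp)]
        have hc := hcongr (T.erase a) (by simp)
        refine ⟨(hT _ hsub hlt.le).congr hc.symm, ?_⟩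
        rw [hc.image_eq, Function.update_self]
        exact mem_iInter₂.1 hq _ ⟨hsub, hlt⟩
      · have hsub : T ⊆ s := fun i hi =>
          (Finset.mem_insert.1 (hTs hi)).resolve_left (by rintro rfl; exact haT hi)
        exact (hT T hsub hTc).congr (hcongr T haT).symm

/-- On a compact space of covering dimension at most `n`, a map to `ℝⁿ⁺¹` can be pushed off the
origin by an arbitrarily small change: replace it by a map into the nerve of a fine cover of order
at most `n + 1`, with the vertices of the nerve in general position. -/
theorem CoveringDimLE.exists_ne_zero_near {X : Type*} [TopologicalSpace X] [CompactSpace X]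
    [T2Space X] {n : ℕ} (hX : CoveringDimLE X n) {f : X → Fin (n + 1) → ℝ} (hf : Continuous f)
    {ε : ℝ} (hε : 0 < ε) :
    ∃ g : X → Fin (n + 1) → ℝ, Continuous g ∧ (∀ x, ‖g x - f x‖ < ε) ∧ ∀ x, g x ≠ 0 := by
  classical
  obtain ⟨t, ht⟩ := isCompact_univ.elim_finite_subcover
    (fun x : X => f ⁻¹' Metric.ball (f x) (ε / 2)) (fun x => Metric.isOpen_ball.preimage hf)
    (fun x _ => mem_iUnion.2 ⟨x, Metric.mem_ball_self (half_pos hε)⟩)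
  obtain ⟨𝒱, hfin, hopen, hcov, href, hord⟩ := hX
    ((fun x : X => f ⁻¹' Metric.ball (f x) (ε / 2)) '' (t : Set X)) (t.finite_toSet.image _)
    (by rintro _ ⟨x, _, rfl⟩; exact Metric.isOpen_ball.preimage hf)
    (by rw [sUnion_image]; exact univ_subset_iff.1 ht)
  have hcen : ∀ V : 𝒱, ∃ c : Fin (n + 1) → ℝ, ∀ x ∈ V.1, ‖c - f x‖ < ε / 2 := by
    intro V
    obtain ⟨_, ⟨x, _, rfl⟩, hVU⟩ := href V.1 V.2
    refine ⟨f x, fun y hy => ?_⟩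
    have := hVU hy
    rwa [mem_preimage, Metric.mem_ball, dist_comm, dist_eq_norm] at this
  choose c hc using hcen
  have := hfin.fintype
  obtain ⟨p, hp, hind⟩ := exists_linearIndepOn_near c (half_pos hε) Finset.univ
  obtain ⟨φ, hφ⟩ := PartitionOfUnity.exists_isSubordinate (isClosed_univ (X := X))
    (fun V : 𝒱 => V.1) (fun V => hopen V.1 V.2)
    (fun x _ => by
      obtain ⟨V, hV, hx⟩ := mem_sUnion.1 (hcov.symm ▸ mem_univ x : x ∈ ⋃₀ 𝒱)
      exact mem_iUnion.2 ⟨⟨V, hV⟩, hx⟩)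
  have hφmem : ∀ (V : 𝒱) x, φ V x ≠ 0 → x ∈ V.1 := fun V x h => hφ V (subset_closure h)
  have hsum : ∀ x, ∑ V, φ V x = 1 := fun x => by
    rw [← finsum_eq_sum_of_fintype]; exact φ.sum_eq_one (mem_univ x)
  refine ⟨fun x => ∑ V, φ V x • p V, by fun_prop, fun x => ?_, fun x h0 => ?_⟩
  · have h1 : ∑ V, φ V x • p V - f x = ∑ V, φ V x • (p V - f x) := by
      simp_rw [smul_sub, Finset.sum_sub_distrib, ← Finset.sum_smul, hsum, one_smul]
    rw [h1]
    have h2 : ∀ V, ‖φ V x • (p V - f x)‖ ≤ φ V x * ε := by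
      intro V
      rw [norm_smul, Real.norm_of_nonneg (φ.nonneg V x)]
      by_cases h : φ V x = 0
      · simp [h]
      · refine mul_le_mul_of_nonneg_left ?_ (φ.nonneg V x)
        have h3 := norm_add_le (p V - c V) (c V - f x)
        rw [sub_add_sub_cancel] at h3
        linarith [hp V, hc V x (hφmem V x h)]
    have hex : ∃ V ∈ Finset.univ, φ V x ≠ 0 := by
      by_contra! hcon
      have := hsum x
      rw [Finset.sum_eq_zero hcon] at this
      exact zero_ne_one this
    obtain ⟨V₀, _, hV₀⟩ := hex
    calc ‖∑ V, φ V x • (p V - f x)‖ ≤ ∑ V, ‖φ V x • (p V - f x)‖ := norm_sum_le _ _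
      _ < ∑ V, φ V x * ε := by
        refine Finset.sum_lt_sum (fun V _ => h2 V) ⟨V₀, Finset.mem_univ _, ?_⟩
        rw [norm_smul, Real.norm_of_nonneg (φ.nonneg V₀ x)]
        refine mul_lt_mul_of_pos_left ?_ ((φ.nonneg V₀ x).lt_of_ne' hV₀)
        have h3 := norm_add_le (p V₀ - c V₀) (c V₀ - f x)
        rw [sub_add_sub_cancel] at h3
        linarith [hp V₀, hc V₀ x (hφmem V₀ x hV₀)]
      _ = ε := by rw [← Finset.sum_mul, hsum, one_mul]
  · let T : Finset 𝒱 := Finset.univ.filter fun V => x ∈ V.1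
    have hTcard : T.card ≤ Module.finrank ℝ (Fin (n + 1) → ℝ) := by
      rw [Module.finrank_fin_fun]
      have h1 : (T : Set 𝒱).encard = {V ∈ 𝒱 | x ∈ V}.encard := by
        rw [← Subtype.val_injective.encard_image]
        congr 1
        ext V
        simp [T]
        tauto
      have h2 := hord x
      rw [← h1, encard_coe_eq_coe_finsetCard] at h2
      exact_mod_cast h2
    have hli := hind T (Finset.subset_univ _) hTcard
    have hsupp : ∀ V, V ∉ T → φ V x = 0 := fun V hV => by
      by_contra h
      exact hV (Finset.mem_filter.2 ⟨Finset.mem_univ _, hφmem V x h⟩)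
    have h0' : ∑ V ∈ T, φ V x • p V = 0 := by
      rw [← h0]
      exact Finset.sum_subset (Finset.subset_univ _) fun V _ hV => by rw [hsupp V hV, zero_smul]
    have hz := linearIndepOn_finset_iff.1 hli (fun V => φ V x) h0'
    have hs := hsum x
    rw [Finset.sum_eq_zero fun V _ => ?_] at hs
    · exact zero_ne_one hs
    · by_cases hV : V ∈ T
      · exact hz V hV
      · exact hsupp V hV

/-- A compact metric space of covering dimension at most `n` carries a sequence of continuous
functions of which at most `n` vanish at any one point, and such that every point has arbitrarily
small neighborhoods `{f i > 0}` with infinitely many `i`.  By the Baire category theorem, such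
sequences exist near any given sequence. -/
theorem CoveringDimLE.exists_generic_functions {X : Type*} [MetricSpace X] [CompactSpace X]
    [Nonempty X] {n : ℕ} (hX : CoveringDimLE X n) :
    ∃ f : ℕ → X → ℝ, (∀ i, Continuous (f i)) ∧ (∀ x, {i | f i x = 0}.encard ≤ n) ∧
      ∀ x, ∀ ε > 0, ∀ S : Finset ℕ, ∃ i ∉ S, 0 < f i x ∧ ∀ y, 0 < f i y → dist y x < ε := by
  classical
  let E := BoundedContinuousFunction (ℕ × X) ℝ
  let U : Finset ℕ → Set E := fun T => {f | ∀ x, ∃ i ∈ T, f (i, x) ≠ 0}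
  have hopen : ∀ T, IsOpen (U T) := by
    intro T
    have hcl : IsClosed {q : E × X | ∀ i ∈ T, q.1 (i, q.2) = 0} := by
      simp only [Set.ofPred_forall]
      refine isClosed_biInter fun i _ => isClosed_eq ?_ continuous_const
      fun_prop
    have := (isClosedMap_fst_of_compactSpace _ hcl).isOpen_compl
    convert this using 1
    ext f
    simp [U]
  have hdense : ∀ T ∈ {T : Finset ℕ | T.card = n + 1}, Dense (U T) := by
    intro T hT
    rw [Metric.dense_iff]
    intro f r hr
    let e : Fin (n + 1) ≃ T := (T.equivFinOfCardEq hT).symm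
    obtain ⟨g, hgc, hgf, hg0⟩ := hX.exists_ne_zero_near (f := fun x j => f ((e j : ℕ), x))
      (by fun_prop) (half_pos hr)
    let F : ℕ × X → ℝ := fun q =>
      if h : q.1 ∈ T then g q.2 (e.symm ⟨q.1, h⟩) else f q
    have hF : Continuous F := by
      rw [continuous_prod_of_discrete_left]
      intro i
      by_cases h : i ∈ T
      · simp only [F, h, dite_true]; exact continuous_pi_iff.1 hgc (e.symm ⟨i, h⟩)
      · simp only [F, h, dite_false]; fun_prop
    have hFf : ∀ q, ‖F q - f q‖ ≤ r / 2 := by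
      rintro ⟨i, x⟩
      by_cases h : i ∈ T
      · simp only [F, h, dite_true]
        have := (norm_le_pi_norm (g x - fun j => f ((e j : ℕ), x)) (e.symm ⟨i, h⟩)).trans (hgf x).le
        simpa using this
      · simp only [F, h, dite_false]
        simpa using (half_pos hr).le
    let F' : E := f + BoundedContinuousFunction.ofNormedAddCommGroup (fun q => F q - f q)
      (by fun_prop) (r / 2) hFf
    have hF' : ∀ q, F' q = F q := fun q => add_sub_cancel (f q) (F q)
    refine ⟨F', ?_, fun x => ?_⟩
    · rw [Metric.mem_ball]
      refine lt_of_le_of_lt ?_ (half_lt_self hr)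
      rw [BoundedContinuousFunction.dist_le (half_pos hr).le]
      intro q
      rw [hF', dist_eq_norm]
      exact hFf q
    · obtain ⟨j, hj⟩ := Function.ne_iff.1 (hg0 x)
      refine ⟨e j, (e j).2, ?_⟩
      rw [hF']
      simpa [F] using hj
  have hbaire := dense_biInter_of_isOpen (fun T _ => hopen T) (to_countable _) hdense
  -- The sequence to be approximated lists, infinitely often each, bump functions around the
  -- points of a dense sequence.
  let r : ℕ → ℝ := fun i => 1 / ((i.unpair.1.unpair.2 : ℝ) + 1)
  have hr : ∀ i, 0 < r i := fun i => Nat.one_div_pos_of_nat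
  let p : ℕ → X := fun i => denseSeq X i.unpair.1.unpair.1
  let G : ℕ × X → ℝ := fun q => max (-1) (min 1 (3 - 2 * (dist q.2 (p q.1) / r q.1)))
  have hG : Continuous G := by
    rw [continuous_prod_of_discrete_left]
    intro i
    simp only [G]
    fun_prop
  let G' : E := BoundedContinuousFunction.ofNormedAddCommGroup G hG 1 (fun q => by
    rw [Real.norm_eq_abs, abs_le]
    exact ⟨le_max_left _ _, max_le (by norm_num) (min_le_left _ _)⟩)
  have hG' : ∀ q, G' q = G q := fun q => rfl
  obtain ⟨f, hf, hfG⟩ := hbaire.exists_dist_lt G' one_pos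
  have hdist : ∀ q, |G q - f q| < 1 := fun q => by
    rw [← hG', ← Real.dist_eq]
    exact (BoundedContinuousFunction.dist_coe_le_dist q).trans_lt hfG
  refine ⟨fun i x => f (i, x), fun i => by fun_prop, fun x => ?_, fun x ε hε S => ?_⟩
  · by_contra! hlt
    have h1 : ((n + 1 : ℕ) : ℕ∞) ≤ {i | f (i, x) = 0}.encard := by
      push_cast
      exact Order.add_one_le_of_lt hlt
    obtain ⟨T, hTsub, hTcard⟩ := exists_subset_encard_eq h1
    have hTfin : T.Finite := finite_of_encard_eq_coe hTcard
    obtain ⟨i, hi, hne⟩ := mem_iInter₂.1 hf hTfin.toFinset (by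
      rw [hTfin.encard_eq_coe_toFinset_card] at hTcard
      exact_mod_cast hTcard) x
    exact hne (hTsub (by simpa using hi))
  · obtain ⟨b, hb⟩ := exists_nat_one_div_lt (show (0 : ℝ) < ε / 3 by positivity)
    have hrb : (0 : ℝ) < 1 / ((b : ℝ) + 1) := Nat.one_div_pos_of_nat
    obtain ⟨a, ha⟩ := (denseRange_denseSeq X).exists_dist_lt x hrb
    obtain ⟨i, hi, hiS⟩ : ∃ i ∈ range (fun m => Nat.pair (Nat.pair a b) m), i ∉ S := by
      refine Set.Infinite.exists_notMem_finset (infinite_range_of_injective fun m m' h => ?_) S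
      simpa using h
    obtain ⟨m, rfl⟩ := hi
    have hri : r (Nat.pair (Nat.pair a b) m) = 1 / ((b : ℝ) + 1) := by simp [r]
    have hpi : p (Nat.pair (Nat.pair a b) m) = denseSeq X a := by simp [p]
    refine ⟨_, hiS, ?_, fun y hy => ?_⟩
    · have h1 : G (Nat.pair (Nat.pair a b) m, x) = 1 := by
        simp only [G, hri, hpi]
        rw [min_eq_left, max_eq_right (by norm_num)]
        have : dist x (denseSeq X a) / (1 / ((b : ℝ) + 1)) ≤ 1 := (div_le_one hrb).2 ha.le
        linarith
      have h2 := hdist (Nat.pair (Nat.pair a b) m, x)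
      rw [h1, abs_lt] at h2
      linarith
    · have h2 := hdist (Nat.pair (Nat.pair a b) m, y)
      by_contra! hcon
      have h1 : G (Nat.pair (Nat.pair a b) m, y) = -1 := by
        simp only [G, hri, hpi]
        refine max_eq_left ((min_le_right _ _).trans ?_)
        have h3 := dist_triangle y (denseSeq X a) x
        rw [dist_comm (denseSeq X a) x] at h3
        have : 2 ≤ dist y (denseSeq X a) / (1 / ((b : ℝ) + 1)) := by
          rw [le_div_iff₀ hrb]
          linarith
        linarith
      rw [h1, abs_lt] at h2
      linarith

/-! ### Zero-dimensional sets -/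

/-- The countable closed sum theorem in dimension zero: if a normal space is the union of countably
many closed sets `F j`, in each of which disjoint closed sets can be separated by a clopen
partition, then disjoint closed sets of the whole space can be separated by a clopen set. -/
theorem exists_isClopen_of_iUnion_closed {Z : Type*} [TopologicalSpace Z] [NormalSpace Z]
    (F : ℕ → Set Z) (hF : ⋃ j, F j = univ)
    (hsep : ∀ j, ∀ C D : Set Z, IsClosed C → IsClosed D → Disjoint C D →
      ∃ P Q : Set Z, IsClosed P ∧ IsClosed Q ∧ Disjoint P Q ∧ P ∪ Q = F j ∧
        C ∩ F j ⊆ P ∧ D ∩ F j ⊆ Q)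
    {C D : Set Z} (hC : IsClosed C) (hD : IsClosed D) (hCD : Disjoint C D) :
    ∃ K : Set Z, IsClopen K ∧ C ⊆ K ∧ Disjoint K D := by
  let PairSpace := {p : Set Z × Set Z // Disjoint (closure p.1) (closure p.2)}
  have hstep : ∀ j, ∀ p : PairSpace, ∃ q : PairSpace, IsOpen q.1.1 ∧ IsOpen q.1.2 ∧
      closure p.1.1 ⊆ q.1.1 ∧ closure p.1.2 ⊆ q.1.2 ∧ F j ⊆ q.1.1 ∪ q.1.2 := by
    rintro j ⟨⟨U, V⟩, hUV⟩
    obtain ⟨P, Q, hP, hQ, hPQ, hPQF, hUP, hVQ⟩ :=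
      hsep j (closure U) (closure V) isClosed_closure isClosed_closure hUV
    have hPF : P ⊆ F j := hPQF ▸ subset_union_left
    have hQF : Q ⊆ F j := hPQF ▸ subset_union_right
    have hdisj : Disjoint (closure U ∪ P) (closure V ∪ Q) := by
      rw [disjoint_union_left, disjoint_union_right, disjoint_union_right]
      refine ⟨⟨hUV, ?_⟩, ?_, hPQ⟩
      · rw [Set.disjoint_left] at hPQ ⊢
        exact fun z hz hzQ => hPQ (hUP ⟨hz, hQF hzQ⟩) hzQ
      · rw [Set.disjoint_left] at hPQ ⊢
        exact fun z hzP hz => hPQ hzP (hVQ ⟨hz, hPF hzP⟩)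
    obtain ⟨U', hU', hUU', hU'V⟩ := normal_exists_closure_subset (isClosed_closure.union hP)
      (isClosed_closure.union hQ).isOpen_compl (subset_compl_iff_disjoint_right.2 hdisj)
    obtain ⟨V', hV', hVV', hV'U⟩ := normal_exists_closure_subset (isClosed_closure.union hQ)
      isClosed_closure.isOpen_compl (subset_compl_comm.1 hU'V)
    refine ⟨⟨(U', V'), (subset_compl_iff_disjoint_right.1 hV'U).symm⟩, hU', hV',
      subset_union_left.trans hUU', subset_union_left.trans hVV', ?_⟩
    rw [← hPQF]
    exact union_subset_union (subset_union_right.trans hUU') (subset_union_right.trans hVV')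
  choose next hnU hnV hclU hclV hcov using hstep
  let seq : ℕ → PairSpace := fun j => Nat.rec
    ⟨(C, D), by simpa only [hC.closure_eq, hD.closure_eq] using hCD⟩ (fun j p => next j p) j
  have hmonoU : Monotone fun j => (seq j).1.1 := monotone_nat_of_le_succ fun j => by
    exact subset_closure.trans (hclU j (seq j))
  have hmonoV : Monotone fun j => (seq j).1.2 := monotone_nat_of_le_succ fun j => by
    exact subset_closure.trans (hclV j (seq j))
  have hdisj : Disjoint (⋃ j, (seq (j + 1)).1.1) (⋃ j, (seq (j + 1)).1.2) := by
    rw [Set.disjoint_left]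
    intro z hz hz'
    obtain ⟨i, hi⟩ := mem_iUnion.1 hz
    obtain ⟨j, hj⟩ := mem_iUnion.1 hz'
    have h := (seq (max i j + 1)).2
    rw [Set.disjoint_left] at h
    exact h (subset_closure (hmonoU (Nat.succ_le_succ (le_max_left i j)) hi))
      (subset_closure (hmonoV (Nat.succ_le_succ (le_max_right i j)) hj))
  have hunion : (⋃ j, (seq (j + 1)).1.1) ∪ (⋃ j, (seq (j + 1)).1.2) = univ := by
    rw [← iUnion_union_distrib, eq_univ_iff_forall]
    intro z
    obtain ⟨j, hj⟩ := mem_iUnion.1 (hF ▸ mem_univ z : z ∈ ⋃ j, F j)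
    exact mem_iUnion.2 ⟨j, hcov j _ hj⟩
  have hopU : IsOpen (⋃ j, (seq (j + 1)).1.1) := isOpen_iUnion fun j => hnU j _
  have hopV : IsOpen (⋃ j, (seq (j + 1)).1.2) := isOpen_iUnion fun j => hnV j _
  have hcompl : (⋃ j, (seq (j + 1)).1.1)ᶜ = ⋃ j, (seq (j + 1)).1.2 :=
    IsCompl.compl_eq ⟨hdisj, codisjoint_iff.2 hunion⟩
  refine ⟨⋃ j, (seq (j + 1)).1.1, ⟨⟨?_⟩, hopU⟩, ?_, hdisj.mono_right ?_⟩
  · rw [hcompl]; exact hopV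
  · exact (show C ⊆ (seq 1).1.1 from hmonoU zero_le_one).trans
      (subset_iUnion (fun j => (seq (j + 1)).1.1) 0)
  · exact (show D ⊆ (seq 1).1.2 from hmonoV zero_le_one).trans
      (subset_iUnion (fun j => (seq (j + 1)).1.2) 0)

/-- If a sequence of functions has exactly `c` zeros at every point of `Z`, and infinitely many of
them suffice for a base of the topology, then disjoint closed subsets of `Z` can be separated by a
clopen set.  On the closed set of points with a given zero set `S` the functions with index outside
`S` have no zeros, so their signs partition it into clopen pieces; there are countably many
choices of `S`. -/
theorem exists_isClopen_of_ncard_zeros_eq {Z : Type*} [TopologicalSpace Z] [NormalSpace Z]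
    {f : ℕ → Z → ℝ} (hf : ∀ i, Continuous (f i)) {c : ℕ} (hfin : ∀ z, {i | f i z = 0}.Finite)
    (hc : ∀ z, {i | f i z = 0}.ncard = c)
    (hbase : ∀ z, ∀ O ∈ 𝓝 z, ∀ S : Finset ℕ, ∃ i ∉ S, 0 < f i z ∧ ∀ y, 0 < f i y → y ∈ O)
    {C D : Set Z} (hC : IsClosed C) (hD : IsClosed D) (hCD : Disjoint C D) :
    ∃ K : Set Z, IsClopen K ∧ C ⊆ K ∧ Disjoint K D := by
  classical
  let FS : Finset ℕ → Set Z := fun S => if S.card = c then {z | ∀ i ∈ S, f i z = 0} else ∅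
  have hFS : ∀ S z, z ∈ FS S → ∀ i, f i z = 0 ↔ i ∈ S := by
    intro S z hz i
    by_cases hS : S.card = c
    · simp only [FS, hS, if_true] at hz
      have h1 : (S : Set ℕ) = {i | f i z = 0} := by
        refine eq_of_subset_of_ncard_le (fun i hi => hz i hi) ?_ (hfin z)
        rw [hc, ncard_coe_finset, hS]
      exact (Set.ext_iff.1 h1 i).symm
    · simp [FS, hS] at hz
  have hFSc : ∀ S, IsClosed (FS S) := by
    intro S
    by_cases hS : S.card = c
    · simp only [FS, hS, if_true, Set.ofPred_forall]
      exact isClosed_biInter fun i _ => isClosed_eq (hf i) continuous_const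
    · simp [FS, hS]
  let F : ℕ → Set Z := fun j => ((Encodable.decode j : Option (Finset ℕ)).map FS).getD ∅
  refine exists_isClopen_of_iUnion_closed F ?_ ?_ hC hD hCD
  · rw [eq_univ_iff_forall]
    intro z
    refine mem_iUnion.2 ⟨Encodable.encode (hfin z).toFinset, ?_⟩
    have h1 : (hfin z).toFinset.card = c := by
      rw [← hc z, ncard_eq_toFinset_card _ (hfin z)]
    simp [F, FS, h1]
  · intro j C D hC hD hCD
    rcases hdec : (Encodable.decode j : Option (Finset ℕ)) with _ | S
    · exact ⟨∅, ∅, isClosed_empty, isClosed_empty, disjoint_empty _, by simp [F, hdec],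
        by simp [F, hdec], by simp [F, hdec]⟩
    have hFj : F j = FS S := by simp [F, hdec]
    rw [hFj]
    -- The indices of the base elements that meet at most one of `C` and `D`, those missing `D`
    -- among them, and the sets where `m` is the first such index with `f m > 0`.
    let G : Set ℕ := {i | i ∉ S ∧ ((∀ y ∈ C, f i y ≤ 0) ∨ ∀ y ∈ D, f i y ≤ 0)}
    let N : Set ℕ := {i | ∀ y ∈ D, f i y ≤ 0}
    let W : ℕ → Set Z := fun m => {z | 0 < f m z ∧ ∀ i < m, i ∈ G → f i z < 0}
    have hW : ∀ m, IsOpen (W m) := by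
      intro m
      have : W m = {z | 0 < f m z} ∩ ⋂ i ∈ {i | i < m ∧ i ∈ G}, {z | f i z < 0} := by
        ext z; simp [W]
      rw [this]
      refine (isOpen_lt continuous_const (hf m)).inter
        (Set.Finite.isOpen_biInter ((finite_lt_nat m).subset fun i hi => hi.1) fun i _ =>
          isOpen_lt (hf i) continuous_const)
    have hex : ∀ z ∈ FS S, ∃ m ∈ G, z ∈ W m := by
      intro z hz
      have hne : ∃ m, m ∈ G ∧ 0 < f m z := by
        by_cases hzC : z ∈ C
        · obtain ⟨i, hiS, hi, hiO⟩ := hbase z Dᶜ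
            (hD.isOpen_compl.mem_nhds (Set.disjoint_left.1 hCD hzC)) S
          exact ⟨i, ⟨hiS, Or.inr fun y hy => not_lt.1 fun h => hiO y h hy⟩, hi⟩
        · obtain ⟨i, hiS, hi, hiO⟩ := hbase z Cᶜ (hC.isOpen_compl.mem_nhds hzC) S
          exact ⟨i, ⟨hiS, Or.inl fun y hy => not_lt.1 fun h => hiO y h hy⟩, hi⟩
      refine ⟨Nat.find hne, (Nat.find_spec hne).1, (Nat.find_spec hne).2, fun i hi hiG => ?_⟩
      have h1 : ¬ 0 < f i z := fun h => Nat.find_min hne hi ⟨hiG, h⟩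
      exact lt_of_le_of_ne (not_lt.1 h1) fun h => hiG.1 ((hFS S z hz i).1 h)
    have hWdisj : ∀ m ∈ G, ∀ m' ∈ G, ∀ z, z ∈ W m → z ∈ W m' → m = m' := by
      intro m hm m' hm' z hz hz'
      rcases lt_trichotomy m m' with h | h | h
      · exact absurd (hz'.2 m h hm) hz.1.not_gt
      · exact h
      · exact absurd (hz.2 m' h hm') hz'.1.not_gt
    let UP : Set Z := ⋃ m ∈ G ∩ N, W m
    let UQ : Set Z := ⋃ m ∈ G \ N, W m
    have hUP : IsOpen UP := isOpen_biUnion fun m _ => hW m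
    have hUQ : IsOpen UQ := isOpen_biUnion fun m _ => hW m
    have hUPQ : ∀ z, z ∈ UP → z ∈ UQ → False := by
      intro z hz hz'
      obtain ⟨m, hm, hzm⟩ := mem_iUnion₂.1 hz
      obtain ⟨m', hm', hzm'⟩ := mem_iUnion₂.1 hz'
      exact hm'.2 (hWdisj m hm.1 m' hm'.1 z hzm hzm' ▸ hm.2)
    have hor : ∀ z ∈ FS S, z ∈ UP ∨ z ∈ UQ := by
      intro z hz
      obtain ⟨m, hmG, hm⟩ := hex z hz
      by_cases hmN : m ∈ N
      · exact Or.inl (mem_iUnion₂.2 ⟨m, ⟨hmG, hmN⟩, hm⟩)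
      · exact Or.inr (mem_iUnion₂.2 ⟨m, ⟨hmG, hmN⟩, hm⟩)
    refine ⟨FS S \ UQ, FS S \ UP, (hFSc S).sdiff hUQ, (hFSc S).sdiff hUP, ?_, ?_, ?_, ?_⟩
    · rw [Set.disjoint_left]
      rintro z ⟨hz, hzQ⟩ ⟨_, hzP⟩
      exact (hor z hz).elim hzP hzQ
    · ext z
      constructor
      · rintro (h | h) <;> exact h.1
      · intro hz
        rcases hor z hz with h | h
        · exact Or.inl ⟨hz, fun h' => hUPQ z h h'⟩
        · exact Or.inr ⟨hz, fun h' => hUPQ z h' h⟩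
    · rintro z ⟨hzC, hz⟩
      refine ⟨hz, fun hzQ => ?_⟩
      obtain ⟨m, hm, hzm⟩ := mem_iUnion₂.1 hzQ
      rcases hm.1.2 with h | h
      · exact (h z hzC).not_gt hzm.1
      · exact hm.2 h
    · rintro z ⟨hzD, hz⟩
      refine ⟨hz, fun hzP => ?_⟩
      obtain ⟨m, hm, hzm⟩ := mem_iUnion₂.1 hzP
      exact (hm.2 z hzD).not_gt hzm.1

/-- Functions `g x`, `x ∈ σ`, on a metric space with disjoint cozero sets, of which that of `g x`
lies within `ε` of `x`.  They encode a finite disjoint family of small open sets with a point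
chosen near each of them. -/
structure IsSmallDisjointFamily {X : Type*} [MetricSpace X] (ε : ℝ) (σ : Finset X)
    (g : X → X → ℝ) : Prop where
  continuous : ∀ x, Continuous (g x)
  nonneg : ∀ x a, 0 ≤ g x a
  mem_of_ne_zero : ∀ x a, g x a ≠ 0 → x ∈ σ
  unique : ∀ x y a, g x a ≠ 0 → g y a ≠ 0 → x = y
  dist_lt : ∀ x a, g x a ≠ 0 → dist x a < ε

/-- A subset of a metric space in which disjoint closed sets can be separated by clopen sets is
covered by finite disjoint families of arbitrarily small open sets of the ambient compact space. -/
theorem exists_isSmallDisjointFamily {X : Type*} [MetricSpace X] [CompactSpace X] {Z : Set X}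
    (hZ : ∀ C D : Set Z, IsClosed C → IsClosed D → Disjoint C D →
      ∃ K : Set Z, IsClopen K ∧ C ⊆ K ∧ Disjoint K D) {ε : ℝ} (hε : 0 < ε) :
    ∃ (σ : Finset X) (g : X → X → ℝ), IsSmallDisjointFamily ε σ g ∧ ∀ a ∈ Z, ∃ x, g x a ≠ 0 := by
  classical
  obtain ⟨σ, hσ⟩ := isCompact_univ.elim_finite_subcover (fun x : X => Metric.ball x (ε / 2))
    (fun x => Metric.isOpen_ball) (fun x _ => mem_iUnion.2 ⟨x, Metric.mem_ball_self (half_pos hε)⟩)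
  have hK : ∀ x : X, ∃ K : Set Z, IsClopen K ∧ (∀ z : Z, dist x z ≤ ε / 2 → z ∈ K) ∧
      ∀ z ∈ K, dist x z < ε := by
    intro x
    obtain ⟨K, hK, h1, h2⟩ := hZ {z | dist x z ≤ ε / 2} {z | ε ≤ dist x z}
      (isClosed_le (by fun_prop) (by fun_prop)) (isClosed_le (by fun_prop) (by fun_prop))
      (Set.disjoint_left.2 fun z (hz : dist x z ≤ ε / 2) (hz' : ε ≤ dist x z) => by linarith)
    exact ⟨K, hK, fun z hz => h1 hz, fun z hz =>
      not_le.1 fun h => Set.disjoint_left.1 h2 hz h⟩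
  choose K hKc hK1 hK2 using hK
  -- Make the clopen sets disjoint by removing from each the earlier ones.
  obtain ⟨e⟩ : Nonempty (σ ≃ Fin σ.card) := ⟨σ.equivFin⟩
  let P : X → Set X := fun x =>
    if hx : x ∈ σ then Subtype.val '' (K x \ ⋃ y ∈ {y : σ | e y < e ⟨x, hx⟩}, K y) else ∅
  have hPσ : ∀ x a, a ∈ P x → x ∈ σ := by
    intro x a ha
    by_contra h
    simp [P, h] at ha
  have hPZ : ∀ x, P x ⊆ Z := by
    intro x a ha
    simp only [P, hPσ x a ha, dite_true] at ha
    obtain ⟨z, _, rfl⟩ := ha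
    exact z.2
  have hPK : ∀ x a, a ∈ P x → dist x a < ε := by
    intro x a ha
    simp only [P, hPσ x a ha, dite_true] at ha
    obtain ⟨z, hz, rfl⟩ := ha
    exact hK2 x z hz.1
  have hPun : ∀ x y a, a ∈ P x → a ∈ P y → x = y := by
    intro x y a hx hy
    have hxσ := hPσ x a hx
    have hyσ := hPσ y a hy
    simp only [P, hxσ, hyσ, dite_true] at hx hy
    obtain ⟨z, hz, rfl⟩ := hx
    obtain ⟨z', hz', hzz'⟩ := hy
    obtain rfl := Subtype.ext hzz'
    rcases lt_trichotomy (e ⟨x, hxσ⟩) (e ⟨y, hyσ⟩) with h | h | h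
    · exact absurd (mem_iUnion₂.2 ⟨⟨x, hxσ⟩, h, hz.1⟩) hz'.2
    · simpa using h
    · exact absurd (mem_iUnion₂.2 ⟨⟨y, hyσ⟩, h, hz'.1⟩) hz.2
  have hPex : ∀ a ∈ Z, ∃ x, a ∈ P x := by
    intro a ha
    have hne : ({y : σ | (⟨a, ha⟩ : Z) ∈ K y} : Set σ).Nonempty := by
      obtain ⟨x, hx, hax⟩ := mem_iUnion₂.1 (hσ (mem_univ a))
      refine ⟨⟨x, hx⟩, hK1 x _ ?_⟩
      rw [dist_comm]
      exact (Metric.mem_ball.1 hax).le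
    obtain ⟨y, hy, hmin⟩ := exists_min_image _ e (toFinite _) hne
    refine ⟨y, ?_⟩
    simp only [P, y.2, dite_true]
    refine ⟨⟨a, ha⟩, ⟨hy, fun h => ?_⟩, rfl⟩
    obtain ⟨y', hy', hay'⟩ := mem_iUnion₂.1 h
    exact (hmin y' hay').not_gt hy'
  have hPclop : ∀ x, IsClopen (Subtype.val ⁻¹' P x : Set Z) := by
    intro x
    by_cases hx : x ∈ σ
    · simp only [P, hx, dite_true, Subtype.val_injective.preimage_image]
      exact (hKc x).diff (Set.Finite.isClopen_biUnion (toFinite _) fun y _ => hKc y)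
    · simp [P, hx, isClopen_empty]
  -- Points closer to `P x` than to the rest of `Z` form disjoint open sets.
  let O : X → Set X := fun x =>
    {a | Metric.infEDist a (P x) < Metric.infEDist a (Z \ P x)} ∩ Metric.ball x ε
  have hO : ∀ x, IsOpen (O x) := fun x =>
    (isOpen_lt Metric.continuous_infEDist Metric.continuous_infEDist).inter Metric.isOpen_ball
  have hPO : ∀ x, P x ⊆ O x := by
    intro x a ha
    refine ⟨?_, by rw [Metric.mem_ball, dist_comm]; exact hPK x a ha⟩
    change Metric.infEDist a (P x) < Metric.infEDist a (Z \ P x)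
    rw [Metric.infEDist_zero_of_mem ha, pos_iff_ne_zero, Ne, ← Metric.mem_closure_iff_infEDist_zero]
    intro hcl
    have h1 : (⟨a, hPZ x ha⟩ : Z) ∈ closure (Subtype.val ⁻¹' P x : Set Z)ᶜ := by
      rw [closure_subtype]
      convert hcl using 2
      ext b
      simp
    rw [(hPclop x).compl.isClosed.closure_eq] at h1
    exact h1 ha
  have hOun : ∀ x y a, a ∈ O x → a ∈ O y → x = y := by
    intro x y a hx hy
    by_contra hne
    have hsub : ∀ x y, x ≠ y → P y ⊆ Z \ P x := fun x y h b hb =>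
      ⟨hPZ y hb, fun hb' => h (hPun x y b hb' hb)⟩
    have h1 := hx.1.trans_le (Metric.infEDist_anti (hsub x y hne))
    have h2 := hy.1.trans_le (Metric.infEDist_anti (hsub y x (Ne.symm hne)))
    exact h1.not_gt h2
  let g : X → X → ℝ := fun x a => if x ∈ σ then (min 1 (Metric.infEDist a (O x)ᶜ)).toReal else 0
  have hgO : ∀ x a, g x a ≠ 0 → x ∈ σ ∧ a ∈ O x := by
    intro x a h
    by_cases hx : x ∈ σ
    · refine ⟨hx, ?_⟩
      by_contra ha
      exact h (by simp [g, hx, Metric.infEDist_zero_of_mem (mem_compl ha)])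
    · simp [g, hx] at h
  refine ⟨σ, g, ⟨fun x => ?_, fun x a => ?_, fun x a h => (hgO x a h).1,
    fun x y a h h' => hOun x y a (hgO x a h).2 (hgO y a h').2, fun x a h => ?_⟩, fun a ha => ?_⟩
  · by_cases hx : x ∈ σ
    · simp only [g, hx, if_true]
      exact ENNReal.continuousOn_toReal.comp_continuous
        (continuous_const.min Metric.continuous_infEDist)
        fun a => ne_top_of_le_ne_top ENNReal.one_ne_top (min_le_left _ _)
    · simp only [g, hx, if_false]
      exact continuous_const
  · simp only [g]
    split_ifs
    · exact ENNReal.toReal_nonneg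
    · exact le_rfl
  · have := (hgO x a h).2.2
    rwa [Metric.mem_ball, dist_comm] at this
  · obtain ⟨x, hx⟩ := hPex a ha
    refine ⟨x, ?_⟩
    simp only [g, hPσ x a hx, if_true]
    refine (ENNReal.toReal_pos ?_ (ne_top_of_le_ne_top ENNReal.one_ne_top (min_le_left _ _))).ne'
    rw [Ne, min_eq_iff]
    rintro (⟨h, _⟩ | ⟨h, _⟩)
    · exact one_ne_zero h
    · rw [← Metric.mem_closure_iff_infEDist_zero, (hO x).isClosed_compl.closure_eq] at h
      exact h (hPO x hx)

/-- A compact metric space of covering dimension at most `n` is a disjoint union of `n + 1`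
zero-dimensional sets, here the level sets of a function `N`. -/
theorem CoveringDimLE.exists_zeroDim_decomposition {X : Type*} [MetricSpace X] [CompactSpace X]
    [Nonempty X] {n : ℕ} (hX : CoveringDimLE X n) :
    ∃ N : X → ℕ, (∀ x, N x ≤ n) ∧ ∀ c, ∀ ε > 0, ∃ (σ : Finset X) (g : X → X → ℝ),
      IsSmallDisjointFamily ε σ g ∧ ∀ a, N a = c → ∃ x, g x a ≠ 0 := by
  obtain ⟨f, hf, hfn, hbase⟩ := hX.exists_generic_functions
  have hfin : ∀ x, {i | f i x = 0}.Finite := fun x =>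
    finite_of_encard_le_coe (hfn x)
  refine ⟨fun x => {i | f i x = 0}.ncard, fun x => ?_, fun c ε hε => ?_⟩
  · have := hfn x
    rw [← (hfin x).cast_ncard_eq] at this
    exact_mod_cast this
  · let Z : Set X := {x | {i | f i x = 0}.ncard = c}
    refine exists_isSmallDisjointFamily (Z := Z)
      (fun C D hC hD hCD => ?_) hε
    refine exists_isClopen_of_ncard_zeros_eq (f := fun i (z : Z) => f i z) (c := c)
      (fun i => (hf i).comp continuous_subtype_val) (fun z => hfin z) (fun z => z.2)
      (fun z O hO S => ?_) hC hD hCD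
    obtain ⟨δ, hδ, hδO⟩ := Metric.mem_nhds_iff.1 hO
    obtain ⟨i, hiS, hi, hiy⟩ := hbase z δ hδ S
    exact ⟨i, hiS, hi, fun y hy => hδO (hiy y hy)⟩

/-! ### Trivial homotopy groups and maps of spheres -/

/-- The sphere `S^r`. -/
abbrev UnitSphere (r : ℕ) : Type := Metric.sphere (0 : EuclideanSpace ℝ (Fin (r + 1))) 1

/-- The sphere `S^(r+1)` is the quotient of the cube of dimension `r + 1` by its boundary.  The
quotient map is the radial homeomorphism `z ↦ z / (1 - ‖z‖)` of the open cube (for the sup norm)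
with `ℝ^(r+1)`, followed by the inverse of the stereographic projection. -/
theorem exists_cube_quotient_sphere (r : ℕ) :
    ∃ q : (Fin (r + 1) → unitInterval) → UnitSphere (r + 1), Continuous q ∧
      Function.Surjective q ∧ ∃ p, (∀ y ∈ Cube.boundary (Fin (r + 1)), q y = p) ∧
        ∀ y y', q y = q y' → y = y' ∨
          (y ∈ Cube.boundary (Fin (r + 1)) ∧ y' ∈ Cube.boundary (Fin (r + 1))) := by
  let z : (Fin (r + 1) → unitInterval) → Fin (r + 1) → ℝ := fun y i => 2 * (y i : ℝ) - 1
  let ρ : (Fin (r + 1) → unitInterval) → ℝ := fun y => 1 - ‖z y‖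
  let s : (Fin (r + 1) → unitInterval) → ℝ := fun y => ∑ i, z y i ^ 2
  have hzc : Continuous z := by fun_prop
  have hzi : ∀ y i, |z y i| ≤ 1 := fun y i => by
    have := (y i).2.1
    have := (y i).2.2
    rw [abs_le]
    constructor <;> simp only [z] <;> linarith
  have hρ0 : ∀ y, 0 ≤ ρ y := fun y =>
    sub_nonneg.2 ((pi_norm_le_iff_of_nonneg zero_le_one).2 fun i => hzi y i)
  have hs0 : ∀ y, 0 ≤ s y := fun y => Finset.sum_nonneg fun i _ => sq_nonneg _
  have hD : ∀ y, 0 < s y + ρ y ^ 2 := by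
    intro y
    refine (add_nonneg (hs0 y) (sq_nonneg _)).lt_of_ne' fun h => ?_
    have h1 : s y = 0 := by linarith [hs0 y, sq_nonneg (ρ y)]
    have h2 : ρ y = 0 := by
      have : ρ y ^ 2 = 0 := by linarith [hs0 y, sq_nonneg (ρ y)]
      simpa using this
    have h3 : z y = 0 := by
      funext i
      have := (Finset.sum_eq_zero_iff_of_nonneg fun i _ => sq_nonneg (z y i)).1 h1 i
        (Finset.mem_univ i)
      simpa using this
    simp [ρ, h3] at h2
  have hbd : ∀ y, y ∈ Cube.boundary (Fin (r + 1)) ↔ ρ y = 0 := by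
    intro y
    constructor
    · rintro ⟨i, hi⟩
      refine le_antisymm (sub_nonpos.2 ?_) (hρ0 y)
      refine le_trans (le_of_eq ?_) (norm_le_pi_norm (z y) i)
      rcases hi with hi | hi <;> norm_num [z, hi]
    · intro h
      by_contra hcon
      have h1 : ‖z y‖ < 1 := by
        rw [pi_norm_lt_iff one_pos]
        intro i
        refine lt_of_le_of_ne (hzi y i) fun h => hcon ⟨i, ?_⟩
        rcases eq_or_eq_neg_of_abs_eq h with h | h
        · exact Or.inr (Subtype.ext (by simp only [z] at h; rw [Set.Icc.coe_one]; linarith))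
        · exact Or.inl (Subtype.ext (by simp only [z] at h; rw [Set.Icc.coe_zero]; linarith))
      simp only [ρ] at h
      linarith
  let Q : (Fin (r + 1) → unitInterval) → EuclideanSpace ℝ (Fin (r + 1 + 1)) := fun y =>
    WithLp.toLp 2 (Fin.cons ((s y - ρ y ^ 2) / (s y + ρ y ^ 2))
      fun i => 2 * ρ y * z y i / (s y + ρ y ^ 2))
  have hQ0 : ∀ y, Q y 0 = (s y - ρ y ^ 2) / (s y + ρ y ^ 2) := fun y => rfl
  have hQs : ∀ y i, Q y (Fin.succ i) = 2 * ρ y * z y i / (s y + ρ y ^ 2) := fun y i => rfl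
  have hQc : Continuous Q := by
    refine (PiLp.continuous_toLp 2 _).comp (continuous_pi fun j => ?_)
    refine Fin.cases ?_ (fun i => ?_) j
    · simp only [Fin.cons_zero]
      exact Continuous.div (by fun_prop) (by fun_prop) fun y => (hD y).ne'
    · simp only [Fin.cons_succ]
      exact Continuous.div (by fun_prop) (by fun_prop) fun y => (hD y).ne'
  have hQn : ∀ y, Q y ∈ Metric.sphere (0 : EuclideanSpace ℝ (Fin (r + 1 + 1))) 1 := by
    intro y
    rw [mem_sphere_zero_iff_norm, EuclideanSpace.norm_eq, Real.sqrt_eq_one, Fin.sum_univ_succ]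
    simp only [hQ0, hQs, Real.norm_eq_abs, sq_abs, div_pow, mul_pow]
    rw [← Finset.sum_div, ← Finset.mul_sum, ← add_div, div_eq_one_iff_eq (pow_pos (hD y) 2).ne']
    change _ + _ * s y = _
    ring
  -- Away from the boundary, `z y` can be recovered from the stereographic coordinates.
  have hrec : ∀ y, ρ y ≠ 0 → ∀ i, Q y (Fin.succ i) / (1 - Q y 0) = z y i / ρ y := by
    intro y hy i
    have := (hD y).ne'
    rw [hQ0, hQs, one_sub_div this, div_div_div_cancel_right₀ this]
    field_simp
    ring
  have hQ1 : ∀ y, Q y 0 = 1 ↔ ρ y = 0 := by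
    intro y
    rw [hQ0, div_eq_one_iff_eq (hD y).ne']
    constructor
    · intro h
      have : ρ y ^ 2 = 0 := by linarith
      simpa using this
    · intro h; rw [h]; ring
  let y₁ : Fin (r + 1) → unitInterval := fun _ => 1
  have hy₁ : y₁ ∈ Cube.boundary (Fin (r + 1)) := ⟨0, Or.inr rfl⟩
  -- The boundary goes to the pole, the only point of the sphere with first coordinate `1`.
  have hpole : ∀ u v : UnitSphere (r + 1), u.1 0 = 1 → v.1 0 = 1 → u = v := by
    have key : ∀ u : UnitSphere (r + 1), u.1 0 = 1 → ∀ i : Fin (r + 1), u.1 (Fin.succ i) = 0 := by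
      intro u hu i
      have h := u.2
      rw [mem_sphere_zero_iff_norm, EuclideanSpace.norm_eq, Real.sqrt_eq_one,
        Fin.sum_univ_succ, hu] at h
      have h1 : ∑ i : Fin (r + 1), ‖u.1 (Fin.succ i)‖ ^ 2 = 0 := by
        simpa using h
      have := (Finset.sum_eq_zero_iff_of_nonneg fun i _ => sq_nonneg _).1 h1 i (Finset.mem_univ i)
      simpa using this
    intro u v hu hv
    ext j
    refine Fin.cases ?_ (fun i => ?_) j
    · rw [hu, hv]
    · rw [key u hu, key v hv]
  refine ⟨fun y => ⟨Q y, hQn y⟩, hQc.subtype_mk _, fun u => ?_, ⟨Q y₁, hQn y₁⟩, fun y hy => ?_,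
    fun y y' h => ?_⟩
  · by_cases hu : u.1 0 = 1
    · exact ⟨y₁, hpole _ _ ((hQ1 y₁).2 ((hbd y₁).1 hy₁)) hu⟩
    · have hn := u.2
      rw [mem_sphere_zero_iff_norm, EuclideanSpace.norm_eq, Real.sqrt_eq_one,
        Fin.sum_univ_succ] at hn
      simp only [Real.norm_eq_abs, sq_abs] at hn
      have hu1 : 1 - u.1 0 ≠ 0 := fun h => hu (by linarith)
      let v : Fin (r + 1) → ℝ := fun i => u.1 (Fin.succ i) / (1 - u.1 0)
      have hv : 0 < 1 + ‖v‖ := by positivity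
      let c : ℝ := 1 / (1 + ‖v‖)
      have hc : 0 < c := by positivity
      have hcv : ‖c • v‖ = 1 - c := by
        rw [norm_smul, Real.norm_of_nonneg hc.le]
        simp only [c]
        field_simp
        ring
      have hci : ∀ i, |c * v i| ≤ 1 := fun i => by
        have := norm_le_pi_norm (c • v) i
        rw [hcv] at this
        exact this.trans (by linarith)
      let y : Fin (r + 1) → unitInterval := fun i => ⟨(c * v i + 1) / 2, by
        have := abs_le.1 (hci i)
        constructor <;> linarith⟩
      have hzy : z y = c • v := by
        funext i
        simp only [z, y, Pi.smul_apply, smul_eq_mul]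
        ring
      have hρy : ρ y = c := by simp only [ρ, hzy, hcv]; ring
      have hsy : s y = c ^ 2 * ((1 + u.1 0) / (1 - u.1 0)) := by
        simp only [s, hzy, Pi.smul_apply, smul_eq_mul, v, mul_pow, div_pow]
        rw [← Finset.mul_sum, ← Finset.sum_div]
        congr 1
        rw [div_eq_div_iff (pow_ne_zero 2 hu1) hu1]
        have : ∑ i : Fin (r + 1), u.1 (Fin.succ i) ^ 2 = (1 + u.1 0) * (1 - u.1 0) := by
          linear_combination hn
        rw [this]; ring
      have hDy : s y + ρ y ^ 2 = c ^ 2 * (2 / (1 - u.1 0)) := by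
        rw [hsy, hρy]; field_simp; ring
      refine ⟨y, ?_⟩
      ext j
      refine Fin.cases ?_ (fun i => ?_) j
      · change Q y 0 = _
        rw [hQ0, hDy, hsy, hρy]
        field_simp
        ring
      · change Q y (Fin.succ i) = _
        rw [hQs, hDy, hρy, hzy]
        simp only [Pi.smul_apply, smul_eq_mul, v]
        field_simp
  · exact hpole _ _ ((hQ1 y).2 ((hbd y).1 hy)) ((hQ1 y₁).2 ((hbd y₁).1 hy₁))
  · have h' : Q y = Q y' := congrArg Subtype.val h
    by_cases hy : ρ y = 0
    · refine Or.inr ⟨(hbd y).2 hy, (hbd y').2 ?_⟩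
      rwa [← hQ1, ← h', hQ1]
    · have hy' : ρ y' ≠ 0 := by rwa [Ne, ← hQ1, ← h', hQ1]
      have hv : (ρ y)⁻¹ • z y = (ρ y')⁻¹ • z y' := by
        funext i
        have := hrec y hy i
        rw [h', hrec y' hy' i] at this
        simp only [Pi.smul_apply, smul_eq_mul, inv_mul_eq_div]
        exact this.symm
      have hnorm : ∀ y, ρ y ≠ 0 → ‖(ρ y)⁻¹ • z y‖ = (ρ y)⁻¹ - 1 := by
        intro y hy
        rw [norm_smul, norm_inv, Real.norm_of_nonneg (hρ0 y)]
        have : ‖z y‖ = 1 - ρ y := by simp [ρ]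
        rw [this, mul_sub, inv_mul_cancel₀ hy, mul_one]
      have hρ : ρ y = ρ y' := by
        have h1 := hnorm y hy
        rw [hv, hnorm y' hy'] at h1
        exact inv_injective (by linarith)
      have hz : z y = z y' := by
        rw [hρ] at hv
        exact smul_right_injective _ (inv_ne_zero hy') hv
      left
      funext i
      have := congrFun hz i
      simp only [z] at this
      exact Subtype.ext (by linarith)

/-- In a path connected space, every map of the zero-sphere is nullhomotopic. -/
theorem PathConnectedSpace.nullhomotopic_sphere_zero {X : Type*} [TopologicalSpace X]
    [PathConnectedSpace X] (f : C(UnitSphere 0, X)) : f.Nullhomotopic := by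
  have hfin : Finite (UnitSphere 0) := by
    have hinj : Function.Injective fun u : UnitSphere 0 => decide (u.1 0 = 1) := by
      have key : ∀ u : UnitSphere 0, u.1 0 = 1 ∨ u.1 0 = -1 := by
        intro u
        have h := u.2
        rw [mem_sphere_zero_iff_norm, EuclideanSpace.norm_eq, Real.sqrt_eq_one] at h
        have h1 : u.1 0 ^ 2 = 1 := by simpa using h
        exact mul_self_eq_one_iff.1 (by rw [← sq, h1])
      intro u v huv
      have huv' : u.1 0 = 1 ↔ v.1 0 = 1 := by simpa using huv
      ext j
      rw [Fin.fin_one_eq_zero j]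
      rcases key u with hu | hu <;> rcases key v with hv | hv
      · rw [hu, hv]
      · rw [hu, huv'.1 hu]
      · rw [hv, huv'.2 hv]
      · rw [hu, hv]
    exact Finite.of_injective _ hinj
  obtain ⟨x₀⟩ : Nonempty X := inferInstance
  have γ : ∀ u, Path (f u) x₀ := fun u => PathConnectedSpace.somePath _ _
  exact ⟨x₀, ⟨{ toFun := fun p => γ p.2 p.1
                continuous_toFun := continuous_prod_of_discrete_right.2 fun u => (γ u).continuous
                map_zero_left := fun u => (γ u).source
                map_one_left := fun u => (γ u).target }⟩⟩

/-- If `π_r` is trivial at all base points, then every map of the `r`-sphere is nullhomotopic. -/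
theorem nullhomotopic_of_subsingleton_pi {X : Type*} [TopologicalSpace X] [Nonempty X] {r : ℕ}
    (h : ∀ x : X, Subsingleton (π_ r X x)) (f : C(UnitSphere r, X)) : f.Nullhomotopic := by
  cases r with
  | zero =>
    obtain ⟨x⟩ : Nonempty X := inferInstance
    have h0 := h x
    have : Subsingleton (ZerothHomotopy X) :=
      (HomotopyGroup.pi0EquivZerothHomotopy (X := X) (x := x)).symm.injective.subsingleton
    have : PathConnectedSpace X := ⟨⟨x⟩, fun x y => Quotient.exact (Subsingleton.elim
      (α := ZerothHomotopy X) (Quotient.mk (pathSetoid X) x) (Quotient.mk (pathSetoid X) y))⟩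
    exact PathConnectedSpace.nullhomotopic_sphere_zero f
  | succ r =>
    obtain ⟨q, hq, hsurj, p, hp, hfib⟩ := exists_cube_quotient_sphere r
    let γ : GenLoop (Fin (r + 1)) X (f p) :=
      ⟨f.comp ⟨q, hq⟩, fun y hy => congrArg f (hp y hy)⟩
    have := h (f p)
    have hrel : GenLoop.Homotopic γ GenLoop.const :=
      Quotient.exact (Subsingleton.elim (α := π_ (r + 1) X (f p)) ⟦γ⟧ ⟦GenLoop.const⟧)
    obtain ⟨H⟩ := hrel
    let Q : C(unitInterval × (Fin (r + 1) → unitInterval), unitInterval × UnitSphere (r + 1)) :=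
      ⟨Prod.map id q, continuous_id.prodMap hq⟩
    have hQ : IsQuotientMap Q := by
      refine IsClosedMap.isQuotientMap ?_ Q.continuous (Function.surjective_id.prodMap hsurj)
      exact Q.continuous.isClosedMap
    have hfac : Function.FactorsThrough H.toContinuousMap Q := by
      rintro ⟨t, y⟩ ⟨t', y'⟩ htt
      obtain ⟨rfl, hyy⟩ : t = t' ∧ q y = q y' := Prod.ext_iff.1 htt
      rcases hfib y y' hyy with rfl | ⟨hy, hy'⟩
      · rfl
      · change H (t, y) = H (t, y')
        rw [H.eq_fst t hy, H.eq_fst t hy']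
        exact congrArg f hyy
    have hlift : ∀ t y, hQ.lift H.toContinuousMap hfac (t, q y) = H (t, y) := fun t y =>
      DFunLike.congr_fun (hQ.lift_comp H.toContinuousMap hfac) (t, y)
    refine ⟨f p, ⟨{ toContinuousMap := hQ.lift H.toContinuousMap hfac
                    map_zero_left := fun u => ?_
                    map_one_left := fun u => ?_ }⟩⟩
    · obtain ⟨y, rfl⟩ := hsurj u
      exact (hlift 0 y).trans (H.apply_zero y)
    · obtain ⟨y, rfl⟩ := hsurj u
      exact (hlift 1 y).trans (H.apply_one y)

/-- In a compact metric space, local `k`-connectedness holds uniformly. -/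
theorem IsLocallyKConnected.exists_uniform {X : Type*} [MetricSpace X] [CompactSpace X] {k : ℕ}
    (hX : IsLocallyKConnected k X) {ε : ℝ} (hε : 0 < ε) :
    ∃ δ > 0, ∀ r ≤ k, ∀ f : C(UnitSphere r, X), (∀ u v, dist (f u) (f v) < δ) →
      ∃ x₀, ∃ H : f.Homotopy (ContinuousMap.const _ x₀), ∀ p q, dist (H p) (H q) < ε := by
  choose V hV hVU hnull using fun x : X => hX x _ (Metric.ball_mem_nhds x (half_pos hε))
  obtain ⟨δ, hδ, hball⟩ := lebesgue_number_lemma_of_metric isCompact_univ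
    (fun x => isOpen_interior (s := V x))
    (fun x _ => mem_iUnion.2 ⟨x, mem_interior_iff_mem_nhds.2 (hV x)⟩)
  refine ⟨δ, hδ, fun r hr f hf => ?_⟩
  obtain ⟨u₀⟩ : Nonempty (UnitSphere r) :=
    (NormedSpace.sphere_nonempty.2 zero_le_one).to_subtype
  obtain ⟨x, hx⟩ := hball (f u₀) (mem_univ _)
  let f' : C(UnitSphere r, V x) := ⟨fun u => ⟨f u, interior_subset (hx (hf u u₀))⟩, by fun_prop⟩
  obtain ⟨c, ⟨H⟩⟩ := hnull x r hr f'
  let K : f.Homotopy (ContinuousMap.const _ c.1) :=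
    { toFun := fun p => (H p).1
      continuous_toFun := by fun_prop
      map_zero_left := fun u => by rw [H.apply_zero]; rfl
      map_one_left := fun u => by rw [H.apply_one]; rfl }
  refine ⟨c.1, K, fun p q => ?_⟩
  have h1 : dist (H p).1 x < ε / 2 := (H p).2
  have h2 : dist (H q).1 x < ε / 2 := (H q).2
  change dist (H p).1 (H q).1 < ε
  linarith [dist_triangle_right (H p).1 (H q).1 x]

/-! ### Filling the boundary of a simplex -/

/-- A homotopy ending in a constant map, composed with a family of points of a compact space that
is only continuous where the time is not `1`, is continuous everywhere. -/
theorem ContinuousMap.Homotopy.continuousOn_comp_cone {W K X : Type*} [TopologicalSpace W]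
    [TopologicalSpace K] [CompactSpace K] [TopologicalSpace X] {g : C(K, X)} {x₀ : X}
    (H : g.Homotopy (ContinuousMap.const _ x₀)) {A : Set W} {t : W → unitInterval} {d : W → K}
    (ht : ContinuousOn t A) (hd : ∀ w ∈ A, t w ≠ 1 → ContinuousWithinAt d A w) :
    ContinuousOn (fun w => H (t w, d w)) A := by
  intro w hw
  by_cases h1 : t w = 1
  · intro O hO
    have hO' : O ∈ 𝓝 x₀ := by
      have : H (t w, d w) = x₀ := by rw [h1]; exact H.apply_one _
      rw [← this]; exact hO
    have hev : ∀ᶠ s in 𝓝 (1 : unitInterval), ∀ u ∈ (univ : Set K), H (s, u) ∈ O := by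
      refine isCompact_univ.eventually_forall_of_forall_eventually fun u _ => ?_
      refine H.continuous.continuousAt.eventually ?_
      have : H (1, u) = x₀ := H.apply_one u
      rw [this]
      exact hO'
    have := (ht w hw).eventually (by rw [h1]; exact hev)
    exact Filter.mem_map.2 (Filter.mem_of_superset this fun v hv => hv _ (mem_univ _))
  · exact H.continuous.continuousAt.comp_continuousWithinAt ((ht w hw).prodMk (hd w hw h1))

/-- A map on the boundary of the standard simplex can be transported to the sphere by central
projection from the barycenter, and a nullhomotopy of the resulting map of the sphere gives an
extension to the simplex with the same image. -/
theorem exists_extension_stdSimplex {X : Type*} [TopologicalSpace X] {r : ℕ}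
    {f : (Fin (r + 2) → ℝ) → X}
    (hf : ContinuousOn f {w | w ∈ stdSimplex ℝ (Fin (r + 2)) ∧ ∃ i, w i = 0}) :
    ∃ g : C(UnitSphere r, X),
      (∀ u, ∃ w ∈ stdSimplex ℝ (Fin (r + 2)), (∃ i, w i = 0) ∧ g u = f w) ∧
      ∀ x₀, ∀ H : g.Homotopy (ContinuousMap.const _ x₀), ∃ G : (Fin (r + 2) → ℝ) → X,
        ContinuousOn G (stdSimplex ℝ (Fin (r + 2))) ∧
        (∀ w ∈ stdSimplex ℝ (Fin (r + 2)), (∃ i, w i = 0) → G w = f w) ∧ ∀ w, ∃ p, G w = H p := by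
  classical
  have hb : (0 : ℝ) < (r : ℝ) + 2 := by positivity
  -- `L` identifies `ℝ^(r+1)` with the vectors of coordinate sum zero; `P` is centered at
  -- the barycenter.
  let L : EuclideanSpace ℝ (Fin (r + 1)) → Fin (r + 2) → ℝ := fun v =>
    Fin.cons (-∑ i, v i) fun i => v i
  let P : (Fin (r + 2) → ℝ) → EuclideanSpace ℝ (Fin (r + 1)) := fun w =>
    WithLp.toLp 2 fun i => w (Fin.succ i) - 1 / ((r : ℝ) + 2)
  let m : EuclideanSpace ℝ (Fin (r + 1)) → ℝ := fun v =>
    Finset.univ.sup' Finset.univ_nonempty fun j => -L v j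
  have hLc : Continuous L := by
    refine continuous_pi fun j => ?_
    refine Fin.cases ?_ (fun i => ?_) j
    · simp only [L, Fin.cons_zero]; fun_prop
    · simp only [L, Fin.cons_succ]; fun_prop
  have hPc : Continuous P := by
    refine (PiLp.continuous_toLp 2 _).comp ?_
    fun_prop
  have hmc : Continuous m :=
    Continuous.finset_sup'_apply _ fun j _ => ((continuous_apply j).comp hLc).neg
  have hLsum : ∀ v, ∑ j, L v j = 0 := fun v => by
    rw [Fin.sum_univ_succ]
    simp [L]
  have hmle : ∀ v j, -L v j ≤ m v := fun v j =>
    Finset.le_sup' (fun j => -L v j) (Finset.mem_univ j)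
  have hmpos : ∀ v, v ≠ 0 → 0 < m v := by
    intro v hv
    by_contra! hm
    have h1 : ∀ j, 0 ≤ L v j := fun j => by linarith [hmle v j]
    have h2 := (Finset.sum_eq_zero_iff_of_nonneg fun j _ => h1 j).1 (hLsum v)
    refine hv ?_
    ext i
    exact h2 (Fin.succ i) (Finset.mem_univ _)
  have hne : ∀ u : UnitSphere r, u.1 ≠ 0 := fun u => by
    have h := u.2
    rw [mem_sphere_zero_iff_norm] at h
    rw [← norm_ne_zero_iff, h]
    exact one_ne_zero
  let S : EuclideanSpace ℝ (Fin (r + 1)) → Fin (r + 2) → ℝ := fun v j =>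
    1 / ((r : ℝ) + 2) + L v j / (((r : ℝ) + 2) * m v)
  have hSmem : ∀ v, v ≠ 0 → S v ∈ stdSimplex ℝ (Fin (r + 2)) ∧ ∃ i, S v i = 0 := by
    intro v hv
    have hm := hmpos v hv
    have hSj : ∀ j, S v j = (m v + L v j) / (((r : ℝ) + 2) * m v) := fun j => by
      simp only [S]; field_simp
    refine ⟨⟨fun j => ?_, ?_⟩, ?_⟩
    · rw [hSj]
      exact div_nonneg (by linarith [hmle v j]) (by positivity)
    · simp only [S]
      rw [Finset.sum_add_distrib, ← Finset.sum_div (f := fun j => L v j), hLsum, Finset.sum_const,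
        Finset.card_univ, Fintype.card_fin, nsmul_eq_mul]
      push_cast
      field_simp
      simp
    · obtain ⟨j, _, hj⟩ := Finset.exists_mem_eq_sup' Finset.univ_nonempty fun j => -L v j
      refine ⟨j, ?_⟩
      have : m v = -L v j := hj
      rw [hSj, this]
      simp
  have hScont : Continuous fun u : UnitSphere r => S u.1 := by
    refine continuous_pi fun j => ?_
    refine continuous_const.add (Continuous.div ?_ ?_ fun u => ?_)
    · exact ((continuous_apply j).comp hLc).comp continuous_subtype_val
    · exact continuous_const.mul (hmc.comp continuous_subtype_val)
    · exact mul_ne_zero hb.ne' (hmpos _ (hne u)).ne'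
  let g : C(UnitSphere r, X) :=
    ⟨fun u => f (S u.1), hf.comp_continuous hScont fun u => hSmem _ (hne u)⟩
  refine ⟨g, fun u => ⟨S u.1, (hSmem _ (hne u)).1, (hSmem _ (hne u)).2, rfl⟩, fun x₀ H => ?_⟩
  obtain ⟨u₀⟩ : Nonempty (UnitSphere r) :=
    (NormedSpace.sphere_nonempty.2 zero_le_one).to_subtype
  let d : (Fin (r + 2) → ℝ) → UnitSphere r := fun w =>
    if h : P w = 0 then u₀ else ⟨‖P w‖⁻¹ • P w, by
      rw [mem_sphere_zero_iff_norm, norm_smul, norm_inv, norm_norm,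
        inv_mul_cancel₀ (norm_ne_zero_iff.2 h)]⟩
  have hdc : ∀ w, P w ≠ 0 → ContinuousAt d w := by
    intro w hw
    rw [Topology.IsInducing.subtypeVal.continuousAt_iff]
    have hev : ∀ᶠ v in 𝓝 w, ‖P v‖⁻¹ • P v = (Subtype.val ∘ d) v := by
      filter_upwards [hPc.continuousAt.eventually_ne hw] with v hv
      simp [d, hv]
    refine ContinuousAt.congr ?_ hev
    exact (hPc.continuousAt.norm.inv₀ (norm_ne_zero_iff.2 hw)).smul hPc.continuousAt
  let μ : (Fin (r + 2) → ℝ) → ℝ := fun w => Finset.univ.inf' Finset.univ_nonempty fun j => w j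
  have hμc : Continuous μ := Continuous.finset_inf'_apply _ fun j _ => continuous_apply j
  have hμle : ∀ w j, μ w ≤ w j := fun w j => Finset.inf'_le _ (Finset.mem_univ j)
  let t : (Fin (r + 2) → ℝ) → unitInterval := fun w =>
    projIcc 0 1 zero_le_one (((r : ℝ) + 2) * μ w)
  have htc : Continuous t := continuous_projIcc.comp (continuous_const.mul hμc)
  have hPL : ∀ w ∈ stdSimplex ℝ (Fin (r + 2)), ∀ j, L (P w) j = w j - 1 / ((r : ℝ) + 2) := by
    intro w hw j
    refine Fin.cases ?_ (fun i => rfl) j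
    have h1 := hw.2
    rw [Fin.sum_univ_succ] at h1
    simp only [L, P, Fin.cons_zero, Finset.sum_sub_distrib, Finset.sum_const, Finset.card_univ,
      Fintype.card_fin, nsmul_eq_mul]
    push_cast
    field_simp
    linear_combination -((r : ℝ) + 2) * h1
  have ht1 : ∀ w ∈ stdSimplex ℝ (Fin (r + 2)), P w = 0 → t w = 1 := by
    intro w hw h0
    have h1 : ∀ j, w j = 1 / ((r : ℝ) + 2) := by
      intro j
      have := hPL w hw j
      have hz : L 0 j = 0 := by
        refine Fin.cases ?_ (fun i => rfl) j
        simp [L]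
      rw [h0, hz] at this
      linarith
    have h2 : μ w = 1 / ((r : ℝ) + 2) := by simp [μ, h1]
    simp only [t, h2]
    rw [mul_one_div_cancel hb.ne']
    exact projIcc_right _
  refine ⟨fun w => H (t w, d w), ?_, fun w hw hw0 => ?_, fun w => ⟨_, rfl⟩⟩
  · refine H.continuousOn_comp_cone htc.continuousOn fun w hw h1 => ?_
    exact (hdc w fun h0 => h1 (ht1 w hw h0)).continuousWithinAt
  · obtain ⟨i, hi⟩ := hw0
    have hμ : μ w = 0 := le_antisymm ((hμle w i).trans hi.le)
      (Finset.le_inf' _ _ fun j _ => hw.1 j)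
    have ht0 : t w = 0 := by
      simp only [t, hμ, mul_zero]
      exact projIcc_left _
    have hP0 : P w ≠ 0 := fun h => by
      have := ht1 w hw h
      rw [ht0] at this
      exact zero_ne_one this
    change H (t w, d w) = f w
    rw [ht0, H.apply_zero]
    change f (S (d w).1) = f w
    congr 1
    have hd : (d w).1 = ‖P w‖⁻¹ • P w := by simp [d, hP0]
    have hn : 0 < ‖P w‖⁻¹ := inv_pos.2 (norm_pos_iff.2 hP0)
    have hLd : ∀ j, L (d w).1 j = ‖P w‖⁻¹ * (w j - 1 / ((r : ℝ) + 2)) := by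
      intro j
      rw [← hPL w hw j, hd]
      refine Fin.cases ?_ (fun i => rfl) j
      simp only [L, Fin.cons_zero, mul_neg, Finset.mul_sum]
      rfl
    have hmd : m (d w).1 = ‖P w‖⁻¹ * (1 / ((r : ℝ) + 2)) := by
      refine le_antisymm (Finset.sup'_le _ _ fun j _ => ?_) ?_
      · rw [hLd, ← mul_neg]
        exact mul_le_mul_of_nonneg_left (by linarith [hw.1 j]) hn.le
      · refine le_trans (le_of_eq ?_) (hmle _ i)
        rw [hLd, hi]
        ring
    funext j
    simp only [S]
    have hn' := (norm_pos_iff.2 hP0).ne'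
    rw [hLd, hmd]
    field_simp
    ring

/-- The simplex with vertex set `σ`: the probability weights supported in `σ`. -/
def face {V : Type*} (σ : Finset V) : Set (V → ℝ) :=
  {w | (∀ x, 0 ≤ w x) ∧ (∀ x ∉ σ, w x = 0) ∧ ∑ x ∈ σ, w x = 1}

/-- The boundary of the simplex with vertex set `σ`. -/
def faceBoundary {V : Type*} (σ : Finset V) : Set (V → ℝ) :=
  {w | w ∈ face σ ∧ ∃ x ∈ σ, w x = 0}

/-- Filling in a simplex with an arbitrary vertex set. -/
theorem exists_extension_face {V X : Type*} [TopologicalSpace X] {r : ℕ} {σ : Finset V}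
    (hσ : σ.card = r + 2) {f : (V → ℝ) → X} (hf : ContinuousOn f (faceBoundary σ)) :
    ∃ g : C(UnitSphere r, X), (∀ u, ∃ w ∈ faceBoundary σ, g u = f w) ∧
      ∀ x₀, ∀ H : g.Homotopy (ContinuousMap.const _ x₀), ∃ G : (V → ℝ) → X,
        ContinuousOn G (face σ) ∧ EqOn G f (faceBoundary σ) ∧ ∀ w, ∃ p, G w = H p := by
  classical
  let e : Fin (r + 2) ≃ σ := (σ.equivFinOfCardEq hσ).symm
  let A : (V → ℝ) → Fin (r + 2) → ℝ := fun w j => w (e j)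
  let B : (Fin (r + 2) → ℝ) → V → ℝ := fun z x => if h : x ∈ σ then z (e.symm ⟨x, h⟩) else 0
  have hA : Continuous A := by fun_prop
  have hB : Continuous B := by
    refine continuous_pi fun x => ?_
    by_cases h : x ∈ σ
    · simp only [B, h, dite_true]; fun_prop
    · simp only [B, h, dite_false]; fun_prop
  have hBA : ∀ w ∈ face σ, B (A w) = w := by
    intro w hw
    funext x
    by_cases h : x ∈ σ
    · simp [B, A, h]
    · simp [B, h, hw.2.1 x h]
  have hAmem : ∀ w ∈ face σ, A w ∈ stdSimplex ℝ (Fin (r + 2)) := by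
    intro w hw
    refine ⟨fun j => hw.1 _, ?_⟩
    rw [← hw.2.2, ← Finset.sum_coe_sort σ]
    exact e.sum_comp fun x => w x
  have hBmem : ∀ z ∈ stdSimplex ℝ (Fin (r + 2)), B z ∈ face σ := by
    intro z hz
    refine ⟨fun x => ?_, fun x hx => by simp [B, hx], ?_⟩
    · by_cases h : x ∈ σ
      · simp [B, h, hz.1]
      · simp [B, h]
    · rw [← hz.2, ← Finset.sum_coe_sort σ, ← e.sum_comp]
      simp [B]
  have hBbd : ∀ z, z ∈ stdSimplex ℝ (Fin (r + 2)) ∧ (∃ i, z i = 0) → B z ∈ faceBoundary σ := by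
    rintro z ⟨hz, i, hi⟩
    exact ⟨hBmem z hz, e i, (e i).2, by simp [B, hi]⟩
  obtain ⟨g, hg, hG⟩ := exists_extension_stdSimplex (f := fun z => f (B z))
    (hf.comp hB.continuousOn hBbd)
  refine ⟨g, fun u => ?_, fun x₀ H => ?_⟩
  · obtain ⟨w, hw, hw0, hgw⟩ := hg u
    exact ⟨B w, hBbd w ⟨hw, hw0⟩, hgw⟩
  · obtain ⟨G, hGc, hGf, hGH⟩ := hG x₀ H
    refine ⟨fun w => G (A w), hGc.comp hA.continuousOn hAmem, ?_, fun w => hGH (A w)⟩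
    rintro w ⟨hw, x, hx, hwx⟩
    change G (A w) = f w
    rw [hGf (A w) (hAmem w hw) ⟨e.symm ⟨x, hx⟩, by simp [A, hwx]⟩, hBA w hw]

/-- In a `k`-connected and locally `k`-connected compact metric space, boundaries of simplices of
dimension at most `k + 1` can be filled in such a way that the filling is as small as desired if
the boundary is small enough.  One filling meets all these demands at once. -/
theorem exists_controlled_filling {X : Type*} [MetricSpace X] [CompactSpace X] {k : ℕ}
    (hL : IsLocallyKConnected k X) (hC : IsKConnected k X) (V : Type*) :
    ∃ δ : ℕ → ℝ, (∀ j, 0 < δ j) ∧ ∀ σ : Finset V, 2 ≤ σ.card → σ.card ≤ k + 2 →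
      ∀ f : (V → ℝ) → X, ContinuousOn f (faceBoundary σ) →
        ∃ G : (V → ℝ) → X, ContinuousOn G (face σ) ∧ EqOn G f (faceBoundary σ) ∧
          ∀ j, (∀ w ∈ faceBoundary σ, ∀ w' ∈ faceBoundary σ, dist (f w) (f w') < δ j) →
            ∀ w w', dist (G w) (G w') < 1 / ((j : ℝ) + 1) := by
  have := hC.nonempty
  have hj : ∀ j : ℕ, (0 : ℝ) < 1 / ((j : ℝ) + 1) := fun j => Nat.one_div_pos_of_nat
  choose δ hδ hfill using fun j : ℕ => hL.exists_uniform (hj j)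
  refine ⟨fun j => min (δ j) (1 / ((j : ℝ) + 1)), fun j => lt_min (hδ j) (hj j), ?_⟩
  intro σ h2 hk f hf
  obtain ⟨r, hr⟩ := Nat.exists_eq_add_of_le' h2
  have hrk : r ≤ k := by omega
  obtain ⟨g, hg, hG⟩ := exists_extension_face hr hf
  let J : Set ℕ := {j | ∀ w ∈ faceBoundary σ, ∀ w' ∈ faceBoundary σ,
    dist (f w) (f w') < min (δ j) (1 / ((j : ℝ) + 1))}
  by_cases hJ : J.Finite
  · rcases J.eq_empty_or_nonempty with hJe | hJne
    · obtain ⟨x₀, ⟨H⟩⟩ := nullhomotopic_of_subsingleton_pi (hC.subsingleton_pi r hrk) g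
      obtain ⟨G, hGc, hGf, -⟩ := hG x₀ H
      refine ⟨G, hGc, hGf, fun j hjJ => ?_⟩
      have : j ∈ J := hjJ
      rw [hJe] at this
      exact this.elim
    · obtain ⟨j₀, hj₀, hmax⟩ := hJ.exists_maximalFor id J hJne
      obtain ⟨x₀, H, hH⟩ := hfill j₀ r hrk g fun u v => by
        obtain ⟨w, hw, hgw⟩ := hg u
        obtain ⟨w', hw', hgw'⟩ := hg v
        rw [hgw, hgw']
        exact (hj₀ w hw w' hw').trans_le (min_le_left _ _)
      obtain ⟨G, hGc, hGf, hGH⟩ := hG x₀ H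
      refine ⟨G, hGc, hGf, fun j hjJ w w' => ?_⟩
      obtain ⟨p, hp⟩ := hGH w
      obtain ⟨p', hp'⟩ := hGH w'
      rw [hp, hp']
      refine (hH p p').trans_le (Nat.one_div_le_one_div ?_)
      by_contra! hlt
      exact absurd (hmax (show j ∈ J from hjJ) hlt.le) (not_le.2 hlt)
  · -- In this case the map on the boundary is constant.
    have hconst : ∀ w ∈ faceBoundary σ, ∀ w' ∈ faceBoundary σ, f w = f w' := by
      intro w hw w' hw'
      refine dist_le_zero.1 (le_of_forall_pos_lt_add fun ε hε => ?_)
      obtain ⟨a, ha⟩ := exists_nat_one_div_lt hε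
      obtain ⟨j, hjJ, haj⟩ := Set.Infinite.exists_gt hJ a
      rw [zero_add]
      exact ((hjJ w hw w' hw').trans_le (min_le_right _ _)).trans
        ((Nat.one_div_le_one_div haj.le).trans_lt ha)
    rcases (faceBoundary σ).eq_empty_or_nonempty with he | ⟨w₀, hw₀⟩
    · obtain ⟨x₀⟩ := hC.nonempty
      exact ⟨fun _ => x₀, continuousOn_const, by rw [he]; exact eqOn_empty _ _,
        fun j _ w w' => by rw [dist_self]; exact hj j⟩
    · exact ⟨fun _ => f w₀, continuousOn_const, fun w hw => hconst w₀ hw₀ w hw,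
        fun j _ w w' => by rw [dist_self]; exact hj j⟩

theorem isClosed_face {V : Type*} (σ : Finset V) : IsClosed (face σ) := by
  simp only [face, Set.ofPred_and, Set.ofPred_forall]
  refine (isClosed_iInter fun x => isClosed_le continuous_const (continuous_apply x)).inter
    (IsClosed.inter (isClosed_iInter fun x => isClosed_iInter fun _ =>
      isClosed_eq (continuous_apply x) continuous_const) (isClosed_eq ?_ continuous_const))
  exact continuous_finsetSum _ fun x _ => continuous_apply x

theorem single_mem_face {V : Type*} [DecidableEq V] {σ : Finset V} {x : V} (hx : x ∈ σ) :
    (Pi.single x 1 : V → ℝ) ∈ face σ := by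
  refine ⟨fun y => ?_, fun y hy => ?_, ?_⟩
  · by_cases h : y = x
    · subst h; simp
    · simp [h]
  · exact Pi.single_eq_of_ne (by rintro rfl; exact hy hx) _
  · rw [Finset.sum_pi_single']
    simp [hx]

theorem face_nonempty_of_mem {V : Type*} {σ : Finset V} {w : V → ℝ} (hw : w ∈ face σ) :
    σ.Nonempty := by
  rw [Finset.nonempty_iff_ne_empty]
  rintro rfl
  simpa using hw.2.2

theorem mem_face_of_subset {V : Type*} {σ τ : Finset V} {w : V → ℝ} (hw : w ∈ face σ)
    (hτ : τ ⊆ σ) (h : ∀ x ∈ σ, x ∉ τ → w x = 0) : w ∈ face τ := by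
  refine ⟨hw.1, fun x hx => ?_, ?_⟩
  · by_cases hxσ : x ∈ σ
    · exact h x hxσ hx
    · exact hw.2.1 x hxσ
  · rw [← hw.2.2]
    exact Finset.sum_subset hτ h

theorem continuousOn_biUnion_of_isClosed {ι Y X : Type*} [TopologicalSpace Y] [TopologicalSpace X]
    {f : Y → X} {I : Set ι} (hI : I.Finite) {A : ι → Set Y} (hA : ∀ i ∈ I, IsClosed (A i))
    (hf : ∀ i ∈ I, ContinuousOn f (A i)) : ContinuousOn f (⋃ i ∈ I, A i) := by
  have := hI.to_subtype
  rw [biUnion_eq_iUnion]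
  exact (locallyFinite_of_finite _).continuousOn_iUnion (fun i => hA i i.2) fun i => hf i i.2

/-- In a `k`-connected and locally `k`-connected compact metric space, all simplices of dimension
at most `k + 1` with vertices in `X` can be mapped to `X` simultaneously and compatibly, extending
the identity on vertices, such that small simplices have small images. -/
theorem exists_simplexwise_map {X : Type*} [MetricSpace X] [CompactSpace X] [DecidableEq X] {k : ℕ}
    (hL : IsLocallyKConnected k X) (hC : IsKConnected k X) :
    ∃ F : (X → ℝ) → X, (∀ x, F (Pi.single x 1) = x) ∧
      (∀ σ : Finset X, σ.card ≤ k + 2 → ContinuousOn F (face σ)) ∧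
      ∀ ε > 0, ∃ δ > 0, ∀ σ : Finset X, σ.card ≤ k + 2 → (∀ x ∈ σ, ∀ y ∈ σ, dist x y < δ) →
        ∀ w ∈ face σ, ∀ w' ∈ face σ, dist (F w) (F w') < ε := by
  classical
  suffices h : ∀ m ≤ k + 1, ∃ F : (X → ℝ) → X, (∀ x, F (Pi.single x 1) = x) ∧
      (∀ σ : Finset X, σ.card ≤ m + 1 → ContinuousOn F (face σ)) ∧
      ∀ ε > 0, ∃ δ > 0, ∀ σ : Finset X, σ.card ≤ m + 1 → (∀ x ∈ σ, ∀ y ∈ σ, dist x y < δ) →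
        ∀ w ∈ face σ, ∀ w' ∈ face σ, dist (F w) (F w') < ε from h (k + 1) le_rfl
  intro m
  induction m with
  | zero =>
    intro _
    obtain ⟨x₀⟩ := hC.nonempty
    have hface : ∀ σ : Finset X, σ.card ≤ 0 + 1 → ∀ w ∈ face σ, ∀ w' ∈ face σ, w = w' := by
      intro σ hσ w hw w' hw'
      obtain ⟨x, rfl⟩ := Finset.card_eq_one.1
        (le_antisymm hσ (Finset.card_pos.2 (face_nonempty_of_mem hw)))
      funext y
      by_cases h : y = x
      · subst h
        have h1 := hw.2.2
        have h2 := hw'.2.2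
        rw [Finset.sum_singleton] at h1 h2
        rw [h1, h2]
      · rw [hw.2.1 y (by simpa using h), hw'.2.1 y (by simpa using h)]
    refine ⟨fun w => if h : ∃ x, w = Pi.single x 1 then h.choose else x₀, fun x => ?_,
      fun σ hσ => ?_, fun ε hε => ⟨1, one_pos, fun σ hσ _ w hw w' hw' => ?_⟩⟩
    · have h : ∃ y, (Pi.single x 1 : X → ℝ) = Pi.single y 1 := ⟨x, rfl⟩
      refine (dif_pos h).trans ?_
      by_contra hne
      have h1 := congrFun h.choose_spec x
      rw [Pi.single_eq_same, Pi.single_eq_of_ne (Ne.symm hne)] at h1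
      exact one_ne_zero h1
    · exact Set.Subsingleton.continuousOn (fun w hw w' hw' => hface σ hσ w hw w' hw') _
    · rw [hface σ hσ w hw w' hw', dist_self]
      exact hε
  | succ m ih =>
    intro hm
    obtain ⟨F, hF1, hFc, hFd⟩ := ih (by omega)
    obtain ⟨δ, hδ, hfill⟩ := exists_controlled_filling hL hC X
    have hbd : ∀ σ : Finset X, faceBoundary σ ⊆ ⋃ x ∈ (σ : Set X), face (σ.erase x) := by
      rintro σ w ⟨hw, x, hx, hwx⟩
      refine mem_iUnion₂.2 ⟨x, hx, mem_face_of_subset hw (Finset.erase_subset _ _) ?_⟩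
      intro y hy hyx
      have : y = x := by
        by_contra h
        exact hyx (Finset.mem_erase.2 ⟨h, hy⟩)
      rw [this, hwx]
    have hFbd : ∀ σ : Finset X, σ.card = m + 2 → ContinuousOn F (faceBoundary σ) := by
      intro σ hσ
      refine (continuousOn_biUnion_of_isClosed σ.finite_toSet (fun x _ => isClosed_face _)
        fun x hx => hFc _ ?_).mono (hbd σ)
      rw [Finset.card_erase_of_mem hx]
      omega
    have hex : ∀ σ : Finset X, ∃ G : (X → ℝ) → X, σ.card = m + 2 →
        ContinuousOn G (face σ) ∧ EqOn G F (faceBoundary σ) ∧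
          ∀ j, (∀ w ∈ faceBoundary σ, ∀ w' ∈ faceBoundary σ, dist (F w) (F w') < δ j) →
            ∀ w w', dist (G w) (G w') < 1 / ((j : ℝ) + 1) := by
      intro σ
      by_cases hσ : σ.card = m + 2
      · obtain ⟨G, hG⟩ := hfill σ (by omega) (by omega) F (hFbd σ hσ)
        exact ⟨G, fun _ => hG⟩
      · exact ⟨F, fun h => absurd h hσ⟩
    choose G hG using hex
    let R : (X → ℝ) → Finset X → Prop := fun w σ => σ.card = m + 2 ∧ w ∈ face σ ∧ ∀ x ∈ σ, w x ≠ 0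
    have hR : ∀ w σ τ, R w σ → w ∈ face τ → σ ⊆ τ := by
      intro w σ τ hσ hτ x hx
      by_contra h
      exact hσ.2.2 x hx (hτ.2.1 x h)
    let F' : (X → ℝ) → X := fun w => if h : ∃ σ, R w σ then G h.choose w else F w
    have hF'F : ∀ w, ∀ σ : Finset X, σ.card ≤ m + 1 → w ∈ face σ → F' w = F w := by
      intro w σ hσ hw
      have h : ¬ ∃ τ, R w τ := by
        rintro ⟨τ, hτ⟩
        have := Finset.card_le_card (hR w τ σ hτ hw)
        have := hτ.1
        omega
      simp [F', h]
    have hF'G : ∀ σ : Finset X, σ.card = m + 2 → EqOn F' (G σ) (face σ) := by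
      intro σ hσ w hw
      by_cases hw0 : ∃ x ∈ σ, w x = 0
      · obtain ⟨x, hx, hwx⟩ := mem_iUnion₂.1 (hbd σ ⟨hw, hw0⟩)
        rw [hF'F w _ (by rw [Finset.card_erase_of_mem hx]; omega) hwx]
        exact ((hG σ hσ).2.1 ⟨hw, hw0⟩).symm
      · push Not at hw0
        have h : ∃ τ, R w τ := ⟨σ, hσ, hw, hw0⟩
        have h1 : h.choose = σ := by
          refine Finset.eq_of_subset_of_card_le (hR w _ σ h.choose_spec hw) ?_
          rw [h.choose_spec.1, hσ]
        simp only [F', h, dite_true, h1]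
    refine ⟨F', fun x => ?_, fun σ hσ => ?_, fun ε hε => ?_⟩
    · rw [hF'F _ {x} (by simp) (single_mem_face (Finset.mem_singleton_self x)), hF1]
    · rcases Nat.lt_or_ge (m + 1) σ.card with h | h
      · have hσ' : σ.card = m + 2 := by omega
        exact (hG σ hσ').1.congr (hF'G σ hσ')
      · exact (hFc σ h).congr fun w hw => hF'F w σ h hw
    · obtain ⟨j, hj⟩ := exists_nat_one_div_lt hε
      have hη : 0 < min ε (δ j / 3) := lt_min hε (by have := hδ j; positivity)
      obtain ⟨δ', hδ', hsmall⟩ := hFd _ hη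
      refine ⟨min δ' (δ j / 3), lt_min hδ' (by have := hδ j; positivity), ?_⟩
      intro σ hσ hdist w hw w' hw'
      rcases Nat.lt_or_ge (m + 1) σ.card with h | h
      · have hσ' : σ.card = m + 2 := by omega
        rw [hF'G σ hσ' hw, hF'G σ hσ' hw']
        refine ((hG σ hσ').2.2 j ?_ w w').trans hj
        -- Each point of the boundary lies close to a vertex.
        have hvert : ∀ v ∈ faceBoundary σ, ∃ y ∈ σ, dist (F v) y < δ j / 3 := by
          intro v hv
          obtain ⟨x, hx, hvx⟩ := mem_iUnion₂.1 (hbd σ hv)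
          obtain ⟨y, hy⟩ := face_nonempty_of_mem hvx
          refine ⟨y, Finset.mem_of_mem_erase hy, ?_⟩
          rw [← hF1 y]
          refine (hsmall (σ.erase x) ?_ ?_ v hvx _ ?_).trans_le (min_le_right _ _)
          · rw [Finset.card_erase_of_mem hx]; omega
          · intro a ha b hb
            exact (hdist a (Finset.mem_of_mem_erase ha) b (Finset.mem_of_mem_erase hb)).trans_le
              (min_le_left _ _)
          · exact single_mem_face hy
        intro v hv v' hv'
        obtain ⟨y, hy, hvy⟩ := hvert v hv
        obtain ⟨y', hy', hvy'⟩ := hvert v' hv'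
        have h1 := (hdist y hy y' hy').trans_le (min_le_right _ _)
        have h2 := dist_triangle4 (F v) y y' (F v')
        rw [dist_comm y' (F v')] at h2
        linarith
      · rw [hF'F w σ h hw, hF'F w' σ h hw']
        refine (hsmall σ h (fun a ha b hb => ?_) w hw w' hw').trans_le (min_le_left _ _)
        exact (hdist a ha b hb).trans_le (min_le_left _ _)

/-! ### Contracting a set of dimension at most `k` -/

/-- The tent function with support `[N, N + k + 2]`. -/
noncomputable def tent (k N : ℕ) (s : ℝ) : ℝ := max 0 (min (s - N) (N + k + 2 - s))

theorem tent_nonneg (k N : ℕ) (s : ℝ) : 0 ≤ tent k N s := le_max_left _ _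

theorem tent_ne_zero {k N : ℕ} {s : ℝ} : tent k N s ≠ 0 ↔ (N : ℝ) < s ∧ s < N + k + 2 := by
  have h : tent k N s ≠ 0 ↔ 0 < tent k N s := (tent_nonneg k N s).lt_iff_ne'.symm
  rw [h, tent, lt_max_iff, lt_min_iff]
  simp

theorem continuous_tent (k N : ℕ) : Continuous (tent k N) := by
  unfold tent; fun_prop

section Weights

variable {X : Type*}

/-- The weight of the vertex `x` at the time `s` and the point `a`, before normalization, for a
sequence `g` of families of functions: the `N`-th family is active at the times between `N` and
`N + k + 2`, and only families with `N < M` are taken into account. -/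
noncomputable def rawWeight (k : ℕ) (g : ℕ → X → X → ℝ) (M : ℕ) (s : ℝ) (a x : X) : ℝ :=
  ∑ N ∈ Finset.range M, tent k N s * g N x a

/-- The weights `rawWeight`, normalized to have sum one. -/
noncomputable def vertexWeight [DecidableEq X] (k : ℕ) (σ : ℕ → Finset X)
    (g : ℕ → X → X → ℝ) (M : ℕ) (s : ℝ) (a x : X) : ℝ :=
  rawWeight k g M s a x / ∑ y ∈ (Finset.range M).biUnion σ, rawWeight k g M s a y

variable {k : ℕ} {g : ℕ → X → X → ℝ}

theorem exists_of_rawWeight_ne_zero {M : ℕ} {s : ℝ} {a x : X} (h : rawWeight k g M s a x ≠ 0) :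
    ∃ N < M, (N : ℝ) < s ∧ s < N + k + 2 ∧ g N x a ≠ 0 := by
  obtain ⟨N, hN, hne⟩ := Finset.exists_ne_zero_of_sum_ne_zero h
  have h1 := tent_ne_zero.1 (left_ne_zero_of_mul hne)
  exact ⟨N, Finset.mem_range.1 hN, h1.1, h1.2, right_ne_zero_of_mul hne⟩

theorem rawWeight_eq {M M' : ℕ} (hMM : M ≤ M') {s : ℝ} (hs : s ≤ M) (a x : X) :
    rawWeight k g M' s a x = rawWeight k g M s a x := by
  refine (Finset.sum_subset (Finset.range_mono hMM) fun N _ hN => ?_).symm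
  have : tent k N s = 0 := by
    by_contra h
    have h1 := (tent_ne_zero.1 h).1
    have h2 : (M : ℝ) ≤ N := by exact_mod_cast not_lt.1 fun h => hN (Finset.mem_range.2 h)
    linarith
  rw [this, zero_mul]

variable [MetricSpace X] {ε : ℕ → ℝ} {σ : ℕ → Finset X}

theorem rawWeight_nonneg (hg : ∀ N, IsSmallDisjointFamily (ε N) (σ N) (g N)) (M : ℕ) (s : ℝ)
    (a x : X) : 0 ≤ rawWeight k g M s a x :=
  Finset.sum_nonneg fun N _ => mul_nonneg (tent_nonneg _ _ _) ((hg N).nonneg x a)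

theorem rawWeight_ne_zero (hg : ∀ N, IsSmallDisjointFamily (ε N) (σ N) (g N)) {M N : ℕ} {s : ℝ}
    {a x : X} (hM : N < M) (hs : (N : ℝ) < s) (hs' : s < N + k + 2) (h : g N x a ≠ 0) :
    rawWeight k g M s a x ≠ 0 := by
  refine (Finset.sum_pos' (fun N _ => mul_nonneg (tent_nonneg _ _ _) ((hg N).nonneg x a))
    ⟨N, Finset.mem_range.2 hM, mul_pos ?_ (((hg N).nonneg x a).lt_of_ne' h)⟩).ne'
  exact (tent_nonneg _ _ _).lt_of_ne' (tent_ne_zero.2 ⟨hs, hs'⟩)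

theorem continuous_rawWeight (hg : ∀ N, IsSmallDisjointFamily (ε N) (σ N) (g N)) (M : ℕ) (x : X) :
    Continuous fun p : ℝ × X => rawWeight k g M p.1 p.2 x :=
  continuous_finsetSum _ fun N _ => ((continuous_tent k N).comp continuous_fst).mul
    (((hg N).continuous x).comp continuous_snd)

variable [DecidableEq X]

theorem vertexWeight_eq (hg : ∀ N, IsSmallDisjointFamily (ε N) (σ N) (g N)) {M M' : ℕ}
    (hMM : M ≤ M') {s : ℝ} (hs : s ≤ M) (a : X) :
    vertexWeight k σ g M' s a = vertexWeight k σ g M s a := by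
  funext x
  simp only [vertexWeight, rawWeight_eq hMM hs]
  congr 1
  refine (Finset.sum_subset (Finset.biUnion_subset_biUnion_of_subset_left _
    (Finset.range_mono hMM)) fun y _ hy => ?_).symm
  by_contra h
  obtain ⟨N, hN, -, -, hNy⟩ := exists_of_rawWeight_ne_zero h
  exact hy (Finset.mem_biUnion.2 ⟨N, Finset.mem_range.2 hN, (hg N).mem_of_ne_zero y a hNy⟩)

/-- At most `k + 2` families are active at each time, so the weights form a point of a simplex with
at most `k + 2` vertices. -/
theorem exists_vertexWeight_mem_face (hg : ∀ N, IsSmallDisjointFamily (ε N) (σ N) (g N)) {a : X}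
    (ha : ∀ m, ∃ N, m ≤ N ∧ N ≤ m + k ∧ ∃ x, g N x a ≠ 0) {M : ℕ} {s : ℝ} (hks : (k : ℝ) + 1 ≤ s)
    (hs : s ≤ M) :
    (∃ τ ⊆ (Finset.range M).biUnion σ, τ.card ≤ k + 2 ∧
      (∀ x ∈ τ, ∃ N : ℕ, (N : ℝ) < s ∧ s < N + k + 2 ∧ g N x a ≠ 0) ∧
      vertexWeight k σ g M s a ∈ face τ) ∧
      0 < ∑ y ∈ (Finset.range M).biUnion σ, rawWeight k g M s a y := by
  have hpos : 0 < ∑ y ∈ (Finset.range M).biUnion σ, rawWeight k g M s a y := by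
    obtain ⟨N, hN1, hN2, x, hx⟩ := ha (⌈s⌉₊ - (k + 1))
    have hk : k + 1 ≤ ⌈s⌉₊ := by
      have : ((k + 1 : ℕ) : ℝ) ≤ ⌈s⌉₊ := by push_cast; exact hks.trans (Nat.le_ceil s)
      exact_mod_cast this
    have hNs : (N : ℝ) < s := Nat.lt_ceil.1 (by omega)
    have hsN : s < N + k + 2 := by
      have h1 : ((⌈s⌉₊ : ℕ) : ℝ) ≤ ((N + k + 1 : ℕ) : ℝ) := by
        exact_mod_cast (by omega : ⌈s⌉₊ ≤ N + k + 1)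
      push_cast at h1
      linarith [Nat.le_ceil s]
    have hNM : N < M := by exact_mod_cast hNs.trans_le hs
    refine Finset.sum_pos' (fun y _ => rawWeight_nonneg hg M s a y) ⟨x, Finset.mem_biUnion.2
      ⟨N, Finset.mem_range.2 hNM, (hg N).mem_of_ne_zero x a hx⟩, ?_⟩
    exact (rawWeight_nonneg hg M s a x).lt_of_ne' (rawWeight_ne_zero hg hNM hNs hsN hx)
  refine ⟨⟨((Finset.range M).biUnion σ).filter fun x => rawWeight k g M s a x ≠ 0,
    Finset.filter_subset _ _, ?_, fun x hx => ?_, fun x => ?_, fun x hx => ?_, ?_⟩, hpos⟩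
  · have hsub : (((Finset.range M).biUnion σ).filter fun x => rawWeight k g M s a x ≠ 0) ⊆
        (Finset.Ico (⌈s⌉₊ - (k + 2)) ⌈s⌉₊).biUnion
          fun N => (σ N).filter fun x => g N x a ≠ 0 := by
      intro x hx
      obtain ⟨N, -, h1, h2, h3⟩ := exists_of_rawWeight_ne_zero (Finset.mem_filter.1 hx).2
      have h4 : ⌈s⌉₊ ≤ N + k + 2 := Nat.ceil_le.2 (by push_cast; exact h2.le)
      have h5 : N < ⌈s⌉₊ := Nat.lt_ceil.2 h1
      exact Finset.mem_biUnion.2 ⟨N, Finset.mem_Ico.2 ⟨by omega, h5⟩,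
        Finset.mem_filter.2 ⟨(hg N).mem_of_ne_zero x a h3, h3⟩⟩
    refine (Finset.card_le_card hsub).trans ((Finset.card_biUnion_le_card_mul _ _ 1
      fun N _ => ?_).trans ?_)
    · refine Finset.card_le_one.2 fun x hx y hy => ?_
      exact (hg N).unique x y a (Finset.mem_filter.1 hx).2 (Finset.mem_filter.1 hy).2
    · rw [Nat.card_Ico]
      omega
  · obtain ⟨N, -, h⟩ := exists_of_rawWeight_ne_zero (Finset.mem_filter.1 hx).2
    exact ⟨N, h⟩
  · exact div_nonneg (rawWeight_nonneg hg M s a x) hpos.le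
  · have : rawWeight k g M s a x = 0 := by
      by_contra h
      obtain ⟨N, hN, -, -, hNx⟩ := exists_of_rawWeight_ne_zero h
      exact hx (Finset.mem_filter.2 ⟨Finset.mem_biUnion.2
        ⟨N, Finset.mem_range.2 hN, (hg N).mem_of_ne_zero x a hNx⟩, h⟩)
    rw [vertexWeight, this, zero_div]
  · simp only [vertexWeight]
    rw [← Finset.sum_div, Finset.sum_filter_ne_zero, div_self hpos.ne']

theorem continuousOn_vertexWeight (hg : ∀ N, IsSmallDisjointFamily (ε N) (σ N) (g N)) (M : ℕ) :
    ContinuousOn (fun p : ℝ × X => vertexWeight k σ g M p.1 p.2)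
      {p | 0 < ∑ y ∈ (Finset.range M).biUnion σ, rawWeight k g M p.1 p.2 y} := by
  refine continuousOn_pi.2 fun x => ?_
  refine (continuous_rawWeight hg M x).continuousOn.div ?_ fun p hp => ne_of_gt hp
  exact (continuous_finsetSum _ fun y _ => continuous_rawWeight hg M y).continuousOn

end Weights

/-- In a `k`-connected and locally `k`-connected compact metric space, a union of `k + 1`
zero-dimensional sets `Z c` is contractible in the space.  The homotopy sends a point `a` at time
`s = (k + 1) / t` to the image of the weights `vertexWeight` of finer and finer families covering
the sets `Z c` in cyclic order; any `k + 1` consecutive families cover the union. -/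
theorem contractibleIn_of_zeroDim_union {X : Type*} [MetricSpace X] [CompactSpace X] {k : ℕ}
    (hL : IsLocallyKConnected k X) (hC : IsKConnected k X) {A : Set X} {Z : ℕ → Set X}
    (hA : ∀ a ∈ A, ∃ c ≤ k, a ∈ Z c)
    (hZ : ∀ c, ∀ ε > 0, ∃ (σ : Finset X) (g : X → X → ℝ),
      IsSmallDisjointFamily ε σ g ∧ ∀ a ∈ Z c, ∃ x, g x a ≠ 0) :
    ContractibleIn A := by
  classical
  obtain ⟨x₀⟩ := hC.nonempty
  obtain ⟨F, hF1, hFc, hFd⟩ := exists_simplexwise_map hL hC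
  -- The first `k + 1` families consist of the single point `x₀`.
  let ε : ℕ → ℝ := fun N => if N ≤ k then Metric.diam (univ : Set X) + 1 else 1 / ((N : ℝ) + 1)
  have hfam : ∀ N : ℕ, ∃ (σ : Finset X) (g : X → X → ℝ), IsSmallDisjointFamily (ε N) σ g ∧
      (N ≤ k → (∀ x a, g x a ≠ 0 → x = x₀) ∧ ∀ a, g x₀ a ≠ 0) ∧
      (k < N → ∀ a ∈ Z (N % (k + 1)), ∃ x, g x a ≠ 0) := by
    intro N
    by_cases hN : N ≤ k
    · have hx : ∀ x a : X, (if x = x₀ then (1 : ℝ) else 0) ≠ 0 → x = x₀ := fun x a h => by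
        by_contra hx
        exact h (if_neg hx)
      refine ⟨{x₀}, fun x _ => if x = x₀ then 1 else 0, ⟨fun x => continuous_const,
        fun x a => by split_ifs <;> norm_num,
        fun x a h => Finset.mem_singleton.2 (hx x a h),
        fun x y a h h' => (hx x a h).trans (hx y a h').symm, fun x a _ => ?_⟩,
        fun _ => ⟨hx, fun a => by simp⟩, fun h => absurd hN (not_le.2 h)⟩
      have := Metric.dist_le_diam_of_mem (isCompact_univ (X := X)).isBounded (mem_univ x)
        (mem_univ a)
      simp only [ε, hN, if_true]
      linarith
    · obtain ⟨σ, g, hg, hcov⟩ := hZ (N % (k + 1)) (1 / ((N : ℝ) + 1)) Nat.one_div_pos_of_nat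
      exact ⟨σ, g, by simpa only [ε, hN, if_false] using hg, fun h => absurd h hN, fun _ => hcov⟩
  choose σ g hg hg0 hgcov using hfam
  have hcov : ∀ a ∈ A, ∀ m, ∃ N, m ≤ N ∧ N ≤ m + k ∧ ∃ x, g N x a ≠ 0 := by
    intro a ha m
    by_cases hm : m ≤ k
    · exact ⟨m, le_rfl, Nat.le_add_right _ _, x₀, (hg0 m hm).2 a⟩
    · obtain ⟨c, hck, hac⟩ := hA a ha
      have hmod : (m + (c + (k + 1) - m % (k + 1)) % (k + 1)) % (k + 1) = c := by
        have h1 : m % (k + 1) < k + 1 := Nat.mod_lt _ k.succ_pos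
        have h2 : m + (c + (k + 1) - m % (k + 1)) = c + (k + 1) + (k + 1) * (m / (k + 1)) := by
          have := Nat.mod_add_div m (k + 1)
          omega
        rw [Nat.add_mod_mod, h2, Nat.add_mul_mod_self_left, Nat.add_mod_right,
          Nat.mod_eq_of_lt (by omega)]
      have hlt : (c + (k + 1) - m % (k + 1)) % (k + 1) < k + 1 := Nat.mod_lt _ k.succ_pos
      refine ⟨m + (c + (k + 1) - m % (k + 1)) % (k + 1), Nat.le_add_right _ _, by omega, ?_⟩
      exact hgcov _ (by omega) a (by rw [hmod]; exact hac)
  let s : unitInterval → ℝ := fun t => ((k : ℝ) + 1) / (t : ℝ)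
  have hs1 : ∀ t : unitInterval, t ≠ 0 → (k : ℝ) + 1 ≤ s t := by
    intro t ht
    have ht0 : (0 : ℝ) < t := unitInterval.pos_iff_ne_zero.2 ht
    rw [le_div_iff₀ ht0]
    exact mul_le_of_le_one_right (by positivity) t.2.2
  let h : unitInterval × A → X := fun p =>
    if p.1 = 0 then p.2 else F (vertexWeight k σ g ⌈s p.1⌉₊ (s p.1) p.2)
  have hh : ∀ p : unitInterval × A, p.1 ≠ 0 → ∀ M : ℕ, s p.1 ≤ M →
      h p = F (vertexWeight k σ g M (s p.1) p.2) := by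
    intro p hp M hM
    simp only [h, hp, if_false]
    rw [vertexWeight_eq hg (Nat.ceil_le.2 hM) (Nat.le_ceil _)]
  have hcont : Continuous h := by
    rw [continuous_iff_continuousAt]
    rintro ⟨t₀, a₀⟩
    by_cases ht₀ : t₀ = 0
    · subst ht₀
      rw [Metric.continuousAt_iff']
      intro η hη
      obtain ⟨δ, hδ, hδF⟩ := hFd (η / 3) (by positivity)
      obtain ⟨n, hn⟩ := exists_nat_one_div_lt (lt_min (half_pos hδ) (show 0 < η / 3 by positivity))
      -- At times beyond `B`, only families with small members are active.
      let B : ℝ := (n : ℝ) + k + (k + 2)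
      have hB : 0 < B := by positivity
      have hev1 : ∀ᶠ p : unitInterval × A in 𝓝 (0, a₀), (p.1 : ℝ) < ((k : ℝ) + 1) / B := by
        refine ContinuousAt.eventually_lt (by fun_prop) continuousAt_const ?_
        change (0 : ℝ) < _
        positivity
      have hev2 : ∀ᶠ p : unitInterval × A in 𝓝 (0, a₀), dist (p.2 : X) a₀ < η / 3 := by
        refine ContinuousAt.eventually_lt (by fun_prop) continuousAt_const ?_
        change dist (a₀ : X) a₀ < _
        rw [dist_self]
        positivity
      filter_upwards [hev1, hev2] with p hp1 hp2
      have h0 : h (0, a₀) = a₀ := by simp [h]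
      rw [h0]
      by_cases hp : p.1 = 0
      · simp only [h, hp, if_true]
        linarith
      · have hp0 : (0 : ℝ) < p.1 := unitInterval.pos_iff_ne_zero.2 hp
        have hsB : B < s p.1 := by
          rw [lt_div_iff₀ hB] at hp1
          rw [lt_div_iff₀ hp0]
          linarith
        rw [hh p hp _ (Nat.le_ceil _)]
        obtain ⟨⟨τ, -, hτc, hτ, hmem⟩, -⟩ := exists_vertexWeight_mem_face hg (hcov p.2 p.2.2)
          (hs1 p.1 hp) (Nat.le_ceil (s p.1))
        have hclose : ∀ x ∈ τ, dist x p.2 < min (δ / 2) (η / 3) := by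
          intro x hx
          obtain ⟨N, -, hsN, hNx⟩ := hτ x hx
          have hnN : n + k < N := by
            have : (n : ℝ) + k < N := by simp only [B] at hsB; linarith
            exact_mod_cast this
          have h1 := (hg N).dist_lt x p.2 hNx
          simp only [ε, not_le.2 ((Nat.le_add_left k n).trans_lt hnN), if_false] at h1
          exact h1.trans_le ((Nat.one_div_le_one_div (by omega)).trans hn.le)
        obtain ⟨x, hx⟩ := face_nonempty_of_mem hmem
        have h1 := hδF τ hτc (fun y hy z hz => by
          have h2 := dist_triangle_right y z (p.2 : X)
          linarith [(hclose y hy).trans_le (min_le_left _ _),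
            (hclose z hz).trans_le (min_le_left _ _)]) _ hmem _ (single_mem_face hx)
        rw [hF1] at h1
        have h2 := dist_triangle4 (F (vertexWeight k σ g ⌈s p.1⌉₊ (s p.1) p.2)) x p.2 a₀
        linarith [(hclose x hx).trans_le (min_le_right _ _)]
    · obtain ⟨M, hM⟩ := exists_nat_gt (s t₀)
      have hsc : ContinuousOn (fun p : unitInterval × A => s p.1) {p | p.1 ≠ 0} := by
        refine continuousOn_const.div (by fun_prop) fun p hp => ?_
        exact ne_of_gt (show (0 : ℝ) < p.1 from unitInterval.pos_iff_ne_zero.2 hp)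
      have hopen0 : IsOpen {p : unitInterval × A | p.1 ≠ 0} :=
        isOpen_ne_fun continuous_fst continuous_const
      let W : Set (unitInterval × A) :=
        {p | p.1 ≠ 0} ∩ (fun p : unitInterval × A => s p.1) ⁻¹' Iio (M : ℝ)
      have hW : IsOpen W := hsc.isOpen_inter_preimage hopen0 isOpen_Iio
      -- Near the given point, the weights stay in a finite union of simplices.
      let 𝒯 : Set (Finset X) := {τ | τ ⊆ (Finset.range M).biUnion σ ∧ τ.card ≤ k + 2}
      have h𝒯 : 𝒯.Finite := ((Finset.range M).biUnion σ).powerset.finite_toSet.subset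
        fun τ hτ => Finset.mem_coe.2 (Finset.mem_powerset.2 hτ.1)
      have hFT : ContinuousOn F (⋃ τ ∈ 𝒯, face τ) :=
        continuousOn_biUnion_of_isClosed h𝒯 (fun τ _ => isClosed_face τ) fun τ hτ => hFc τ hτ.2
      have hface := fun p (hp : p ∈ W) => exists_vertexWeight_mem_face hg (hcov p.2 p.2.2)
        (hs1 p.1 hp.1) (le_of_lt (show s p.1 < M from hp.2))
      have hcomp : ContinuousOn
          (fun p : unitInterval × A => F (vertexWeight k σ g M (s p.1) p.2)) W := by
        have h1 : ContinuousOn (fun p : unitInterval × A => vertexWeight k σ g M (s p.1) p.2) W :=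
          (continuousOn_vertexWeight hg M).comp
            (f := fun p : unitInterval × A => ((s p.1, (p.2 : X)) : ℝ × X))
            ((hsc.mono inter_subset_left).prodMk (by fun_prop)) fun p hp => (hface p hp).2
        refine hFT.comp h1 fun p hp => ?_
        obtain ⟨⟨τ, hτ1, hτ2, -, hτ3⟩, -⟩ := hface p hp
        exact mem_iUnion₂.2 ⟨τ, ⟨hτ1, hτ2⟩, hτ3⟩
      have hmem : W ∈ 𝓝 (t₀, a₀) := hW.mem_nhds ⟨ht₀, hM⟩
      refine (hcomp.continuousAt hmem).congr ?_
      filter_upwards [hmem] with p hp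
      exact (hh p hp.1 M (le_of_lt (show s p.1 < M from hp.2))).symm
  refine ⟨x₀, ⟨{ toFun := h, continuous_toFun := hcont, map_zero_left := fun a => by simp [h],
                 map_one_left := fun a => ?_ }⟩⟩
  -- At the final time only the families consisting of `x₀` are active.
  have hs : s 1 = ((k + 1 : ℕ) : ℝ) := by simp [s]
  change h (1, a) = x₀
  rw [hh (1, a) one_ne_zero (k + 1) hs.le]
  obtain ⟨⟨τ, -, hτc, hτ, hmem⟩, -⟩ := exists_vertexWeight_mem_face hg (hcov a a.2)
    (hs1 1 one_ne_zero) hs.le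
  have hτx : ∀ x ∈ τ, x = x₀ := by
    intro x hx
    obtain ⟨N, hN, -, hNx⟩ := hτ x hx
    rw [hs, Nat.cast_lt] at hN
    exact (hg0 N (by omega)).1 x a hNx
  obtain ⟨x, hx⟩ := face_nonempty_of_mem hmem
  have hτ1 : τ = {x₀} := Finset.eq_singleton_iff_unique_mem.2 ⟨hτx x hx ▸ hx, hτx⟩
  have hw : vertexWeight k σ g (k + 1) (s 1) a = Pi.single x₀ 1 := by
    rw [hτ1] at hmem
    funext y
    by_cases hy : y = x₀
    · subst hy
      have := hmem.2.2
      rw [Finset.sum_singleton] at this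
      rw [Pi.single_eq_same]
      exact this
    · rw [Pi.single_eq_of_ne hy]
      exact hmem.2.1 y (by simpa using hy)
  change F (vertexWeight k σ g (k + 1) (s 1) a) = x₀
  rw [hw, hF1]

/-! ### The category estimate -/

theorem LocallyPathConnectedSpace.isLocallyKConnected_zero {X : Type*} [TopologicalSpace X]
    [LocallyPathConnectedSpace X] : IsLocallyKConnected 0 X := by
  intro x U hU
  obtain ⟨V, ⟨hV, hVp⟩, hVU⟩ := (LocallyPathConnectedSpace.path_connected_basis x).mem_iff.1 hU
  refine ⟨V, hV, hVU, fun r hr f => ?_⟩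
  obtain rfl : r = 0 := Nat.le_zero.1 hr
  have : PathConnectedSpace V := isPathConnected_iff_pathConnectedSpace.1 hVp
  exact (PathConnectedSpace.nullhomotopic_sphere_zero f).comp_right _

theorem PathConnectedSpace.isKConnected_zero {X : Type*} [TopologicalSpace X]
    [PathConnectedSpace X] : IsKConnected 0 X := by
  refine ⟨inferInstance, fun r hr x => ?_⟩
  obtain rfl : r = 0 := Nat.le_zero.1 hr
  have : Subsingleton (ZerothHomotopy X) :=
    ⟨fun a b => Quotient.inductionOn₂ a b fun x y => Quotient.sound (PathConnectedSpace.joined x y)⟩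
  exact (HomotopyGroup.pi0EquivZerothHomotopy (X := X) (x := x)).injective.subsingleton

/-- If the `n + 1` zero-dimensional sets are grouped into blocks of `k + 1`, each block is
contractible in the space. -/
theorem generalLSCat_le_div {X : Type*} [TopologicalSpace X] [CompactSpace X] [MetrizableSpace X]
    {k n : ℕ} (hL : IsLocallyKConnected k X) (hC : IsKConnected k X) (hX : CoveringDimLE X n) :
    generalLSCat X ≤ (n / (k + 1) : ℕ) := by
  let := metrizableSpaceMetric X
  have := hC.nonempty
  obtain ⟨c, hcn, hc⟩ := hX.exists_zeroDim_decomposition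
  refine iInf₂_le (n / (k + 1)) ⟨fun i => {x | c x / (k + 1) = i}, ?_, fun i => ?_⟩
  · refine eq_univ_iff_forall.2 fun x => mem_iUnion.2 ⟨⟨c x / (k + 1), ?_⟩, rfl⟩
    exact Nat.lt_succ_of_le (Nat.div_le_div_right (hcn x))
  · refine contractibleIn_of_zeroDim_union hL hC (Z := fun j => {x | c x = i * (k + 1) + j})
      (fun a ha => ⟨c a % (k + 1), Nat.lt_succ_iff.1 (Nat.mod_lt _ k.succ_pos), ?_⟩)
      fun j ε hε => hc _ ε hε
    have h1 : c a / (k + 1) = i := ha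
    change c a = i * (k + 1) + c a % (k + 1)
    rw [← h1, Nat.div_add_mod']

theorem mainTheorem5 {X : Type*} [TopologicalSpace X] [CompactSpace X] [MetrizableSpace X] :
    (∀ k : ℕ, IsLocallyKConnected k X → IsKConnected k X →
      (generalLSCat X : ℝ≥0∞) ≤ (coveringDim X : ℝ≥0∞) / ((k : ℝ≥0∞) + 1)) ∧
    (PathConnectedSpace X → LocallyPathConnectedSpace X →
      generalLSCat X ≤ coveringDim X) := by
  refine ⟨fun k hL hC => ?_, fun _ _ => ?_⟩
  · by_cases hX : ∃ n, CoveringDimLE X n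
    · classical
      have hdim : coveringDim X = (Nat.find hX : ℕ) :=
        le_antisymm (iInf₂_le _ (Nat.find_spec hX))
          (le_iInf₂ fun n hn => by exact_mod_cast Nat.find_min' hX hn)
      have hle := generalLSCat_le_div hL hC (Nat.find_spec hX)
      rw [hdim, ENat.toENNReal_coe, ENNReal.le_div_iff_mul_le (by simp) (by simp)]
      calc (generalLSCat X : ℝ≥0∞) * ((k : ℝ≥0∞) + 1)
          ≤ ((Nat.find hX / (k + 1) : ℕ) : ℝ≥0∞) * ((k + 1 : ℕ) : ℝ≥0∞) := by
            push_cast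
            gcongr
            exact_mod_cast ENat.toENNReal_le.2 hle
        _ ≤ (Nat.find hX : ℝ≥0∞) := by exact_mod_cast Nat.div_mul_le_self _ _
    · have hdim : coveringDim X = ⊤ := by
        push Not at hX
        simp [coveringDim, hX]
      rw [hdim, ENat.toENNReal_top, ENNReal.top_div_of_ne_top (by simp)]
      exact le_top
  · refine le_iInf₂ fun n hn => ?_
    simpa using generalLSCat_le_div LocallyPathConnectedSpace.isLocallyKConnected_zero
      PathConnectedSpace.isKConnected_zero hn
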